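/- Let $\mathcal H$ be a finite family of finite simple graphs, none of which has an isolated vertex, let $r=m(\mathcal H)=\max\{|E(H)| : H\in\mathcal H\}$ be the largest number of edges of a member of $\mathcal H$, and let $t$ be an integer with $0\le t\le r-1$; $\mathcal H$ and $t$ are fixed. The $\mathcal H$-Packing with $t$-Edge-Overlap problem asks, for a finite simple graph $G$ and a non-negative integer $k$ (the parameter), whether $G$ contains a set of at least $k$ subgraphs (not necessarily induced), each isomorphic to some $H\in\mathcal H$, such that $|E(H_i)\cap E(H_j)|\le t$ for any two different subgraphs $H_i,H_j$ of the set. This problem has a kernel with $O(r^r k^{r-t-1})$ vertices. That is, there is an absolute constant $C$ such that for all such $\mathcal H$ and $t$ there is an algorithm which, given an instance $(G,k)$ (with $G$ given by its adjacency matrix and $k$ in binary), computes in time polynomial in the size of the instance (with a polynomial that may depend on $\mathcal H$ and $t$) an instance $(G',k')$ of the same problem such that $k'\le k$, $|V(G')|\le C\,r^r k^{r-t-1}$, and $(G',k')$ is a yes-instance if and only if $(G,k)$ is one. (Here $0^0=1$.) -/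

import Mathlib

namespace PackingKernel

/-! ## A programming language on binary trees with a step count -/

/-- Binary trees, the data on which programs operate. -/
inductive Data : Type
  | nil : Data
  | cons (a b : Data) : Data

namespace Data

/-- The number of nodes of a tree (each leaf and each inner node counts once). -/
def size : Data → ℕ
  | nil => 1
  | cons a b => a.size + b.size + 1

/-- The left subtree (a leaf is its own left subtree). -/
def fst : Data → Data
  | nil => nil
  | cons a _ => a

/-- The right subtree (a leaf is its own right subtree). -/
def snd : Data → Data
  | nil => nil
  | cons _ b => b

end Data

/-- Deterministic programs with one input tree and one output tree. -/
inductive Code : Type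
  /-- return the input -/
  | id : Code
  /-- return the leaf -/
  | nil : Code
  /-- return the left subtree of the input -/
  | fst : Code
  /-- return the right subtree of the input -/
  | snd : Code
  /-- run both programs on the input and join the two results to one tree -/
  | pair (f g : Code) : Code
  /-- run the first program, then the second one on its result -/
  | comp (f g : Code) : Code
  /-- run the test `p` on the input: continue with `f` if it returns the leaf, else with `g` -/
  | cond (p f g : Code) : Code
  /-- while the test `p` does not return the leaf, replace the current tree `x` by `f x` -/
  | loop (p f : Code) : Code

/-- `Run c x y n`: the program `c`, started on `x`, halts with the result `y` after `n` steps.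
An instruction that reads or copies a tree `x` is charged `x.size` steps, so that the sizes of
all trees that occur in a run are bounded by the number of steps, and a Turing machine can
simulate the run with polynomial overhead (and conversely). -/
inductive Run : Code → Data → Data → ℕ → Prop
  | id (x : Data) : Run Code.id x x x.size
  | nil (x : Data) : Run Code.nil x Data.nil x.size
  | fst (x : Data) : Run Code.fst x x.fst x.size
  | snd (x : Data) : Run Code.snd x x.snd x.size
  | pair {f g : Code} {x y z : Data} {m n : ℕ} (hf : Run f x y m) (hg : Run g x z n) :
      Run (Code.pair f g) x (Data.cons y z) (x.size + m + n)
  | comp {f g : Code} {x y z : Data} {m n : ℕ} (hf : Run f x y m) (hg : Run g y z n) :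
      Run (Code.comp f g) x z (1 + m + n)
  | cond_nil {p f g : Code} {x y : Data} {m n : ℕ}
      (hp : Run p x Data.nil m) (hf : Run f x y n) :
      Run (Code.cond p f g) x y (x.size + m + n)
  | cond_cons {p f g : Code} {x a b y : Data} {m n : ℕ}
      (hp : Run p x (Data.cons a b) m) (hg : Run g x y n) :
      Run (Code.cond p f g) x y (x.size + m + n)
  | loop_stop {p f : Code} {x : Data} {m : ℕ} (hp : Run p x Data.nil m) :
      Run (Code.loop p f) x x (x.size + m)
  | loop_step {p f : Code} {x a b y z : Data} {l m n : ℕ}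
      (hp : Run p x (Data.cons a b) m) (hf : Run f x y n) (hl : Run (Code.loop p f) y z l) :
      Run (Code.loop p f) x z (x.size + m + n + l)

/-! ## Encoding of graphs and numbers -/

/-- A finite simple graph, with vertices named `0, …, order - 1`. -/
structure FinGraph : Type where
  order : ℕ
  graph : SimpleGraph (Fin order)

/-- The number of edges. -/
noncomputable def FinGraph.numEdges (H : FinGraph) : ℕ := H.graph.edgeSet.ncard

/-- Booleans as trees. -/
def encodeBool : Bool → Data
  | false => Data.nil
  | true => Data.cons Data.nil Data.nil

/-- Lists of trees as trees. -/
def encodeList : List Data → Data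
  | [] => Data.nil
  | a :: l => Data.cons a (encodeList l)

/-- Natural numbers in binary (least significant bit first). -/
def encodeNat (k : ℕ) : Data := encodeList (k.bits.map encodeBool)

open Classical in
/-- A graph is given by its adjacency matrix, as the list of the rows. -/
noncomputable def encodeGraph (G : FinGraph) : Data :=
  encodeList (List.ofFn fun i => encodeList (List.ofFn fun j =>
    encodeBool (decide (G.graph.Adj i j))))

/-- An instance is a graph together with a natural number, the parameter. -/
noncomputable def encodeInstance (G : FinGraph) (k : ℕ) : Data :=
  Data.cons (encodeGraph G) (encodeNat k)

/-! ## Kernels of parameterized graph problems -/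

/-- `HasVertexKernel Q s`: the graph problem `Q`, whose instances are pairs `(G, k)` with
parameter `k`, has a kernel with at most `s k` vertices. That is, some program computes, in time
polynomial in the size of the encoded instance `(G, k)`, an equivalent instance `(G', k')` of the
same problem with `k' ≤ k` in which `G'` has at most `s k` vertices. -/
def HasVertexKernel (Q : FinGraph → ℕ → Prop) (s : ℕ → ℕ) : Prop :=
  ∃ (c : Code) (p : Polynomial ℕ), ∀ (G : FinGraph) (k : ℕ),
    ∃ (G' : FinGraph) (k' steps : ℕ),
      Run c (encodeInstance G k) (encodeInstance G' k') steps ∧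
      steps ≤ p.eval (encodeInstance G k).size ∧
      (Q G k ↔ Q G' k') ∧
      k' ≤ k ∧
      G'.order ≤ s k

/-! ## The packing problem -/

/-- `m(𝓗)`, the largest number of edges of a graph in the finite family `𝓗`. -/
noncomputable def maxEdges (𝓗 : Finset FinGraph) : ℕ := 𝓗.sup FinGraph.numEdges

/-- The question of `𝓗`-Packing with `t`-Edge-Overlap on the instance `(G, k)`: is there a set of
at least `k` (not necessarily induced) subgraphs of `G`, each isomorphic to a member of `𝓗`, any
two different ones of which have at most `t` edges in common? -/
def EdgeOverlapPacking (𝓗 : Finset FinGraph) (t : ℕ) (G : FinGraph) (k : ℕ) : Prop :=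
  ∃ K : Finset G.graph.Subgraph,
    k ≤ K.card ∧
    (∀ A ∈ K, ∃ H ∈ 𝓗, Nonempty (A.coe ≃g H.graph)) ∧
    (∀ A ∈ K, ∀ B ∈ K, A ≠ B → (A.edgeSet ∩ B.edgeSet).ncard ≤ t)

end PackingKernel

namespace PackingKernel

/-! ## Polynomial-time computable functions -/

/-! Without isolated vertices a copy is determined by its edges. So the question is about the family
`S` of edge sets of copies, each with at most `r` elements: are there `k` of them pairwise sharing
at most `t` elements (`edgeOverlapPacking_iff`, `mem_family_copies`)? Let `P` be a greedy maximal
packing. If `k ≤ |P|`, a trivial yes-instance is returned. If `k > |S|`, the answer is no. If `t = r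
- 1`, distinct members of `S` never share more than `t` elements, so `P` is all of `S` and again `k
> |P|` means no. In both no-cases no edge is kept.

In the remaining case a maximal `M ⊆ S` is chosen greedily such that each `Q` with `t + 1 ≤ |Q| ≤ r
- 1` lies in at most `(r k) ^ (r - 1 - |Q|)` members. A packing member `A` outside `M` was rejected
because of some `Q ⊆ A` at its bound. If `|Q| ≤ r - 2`, there are too many members of `M` around `Q`
for the other `k - 1` packing members to obstruct them all, and `A` can be exchanged for one in `M`
(`exists_replacement`). If `|Q| = r - 1`, then `A` is `Q` plus one element `o`. Hence some packing
has all its members inside `V`, the union of `M`, or of the form `Q + o` with `o` outside `V` and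
`Q` in the family `C` of `(r - 1)`-subsets of members of `M` (`SetPack.exists_near`).

It remains to keep few outside elements. They form a bipartite graph with `C`, and an ascending
auction assigns at most one of them to each `Q`. A gap among the final prices yields a crown `X ⊆ C`
(`IsAuction.exists_crown`): the elements held by `X` are adjacent only to `X`, and unassigned
elements have no neighbours outside `X`. Giving each `Q` in `X` that the packing uses its own
assigned element creates no new overlap, so `V` and the assigned elements suffice
(`IsAuction.setPack`).

Every member of `M` belongs to `P` or shares `t + 1` elements with a member of `P`, whence `|M| ≤ 2
r ^ (r - 1) k ^ (r - t - 1)` (`card_le_of_maximal`). Both `|V|` and `|C|` are at most `r |M|`, and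
each kept edge has two ends, which gives the constant 8.

The running time is handled by closure properties of `PT`: everything reduces to folds over lists
whose accumulators stay polynomially small, and `fun_prop` assembles the programs. -/

theorem Data.one_le_size (x : Data) : 1 ≤ x.size := by
  cases x <;> simp [Data.size]

theorem Data.size_fst_le (x : Data) : x.fst.size ≤ x.size := by
  cases x <;> simp [Data.size, Data.fst]; omega

theorem Data.size_snd_le (x : Data) : x.snd.size ≤ x.size := by
  cases x <;> simp [Data.size, Data.snd]; omega

/-- Each instruction is charged for what it reads or builds. This is what makes polynomial time
closed under composition: a time bound for the first program also bounds the input of the second. -/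
theorem Run.size_le {c : Code} {x y : Data} {n : ℕ} (h : Run c x y n) : y.size ≤ n := by
  induction h with
  | id x => exact le_rfl
  | nil x => exact x.one_le_size
  | fst x => exact x.size_fst_le
  | snd x => exact x.size_snd_le
  | @pair f g x y z m n _ _ h1 h2 => have := x.one_le_size; simp only [Data.size]; omega
  | comp _ _ _ h2 => omega
  | cond_nil _ _ _ h2 => omega
  | cond_cons _ _ _ h2 => omega
  | loop_stop _ _ => omega
  | loop_step _ _ _ _ _ h3 => omega

theorem natPoly_eval_mono (p : Polynomial ℕ) {m n : ℕ} (h : m ≤ n) : p.eval m ≤ p.eval n := by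
  rw [Polynomial.eval_eq_sum, Polynomial.eval_eq_sum]
  unfold Polynomial.sum
  beta_reduce
  gcongr

/-- The program `c` maps `x` to `y` within a number of steps bounded by the polynomial `p`. -/
def RunsIn (c : Code) (p : Polynomial ℕ) (x y : Data) : Prop :=
  ∃ n, Run c x y n ∧ n ≤ p.eval x.size

namespace RunsIn

variable {c d e : Code} {p q r : Polynomial ℕ} {x y z : Data}

theorem size_le (h : RunsIn c p x y) : y.size ≤ p.eval x.size := by
  obtain ⟨n, h1, h2⟩ := h
  exact h1.size_le.trans h2

theorem id : RunsIn Code.id Polynomial.X x x := ⟨_, Run.id x, by simp⟩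

theorem nil : RunsIn Code.nil Polynomial.X x Data.nil := ⟨_, Run.nil x, by simp⟩

theorem fst : RunsIn Code.fst Polynomial.X x x.fst := ⟨_, Run.fst x, by simp⟩

theorem snd : RunsIn Code.snd Polynomial.X x x.snd := ⟨_, Run.snd x, by simp⟩

theorem pair (hc : RunsIn c p x y) (hd : RunsIn d q x z) :
    RunsIn (Code.pair c d) (Polynomial.X + p + q) x (Data.cons y z) := by
  obtain ⟨m, h1, h2⟩ := hc
  obtain ⟨n, h3, h4⟩ := hd
  refine ⟨_, Run.pair h1 h3, ?_⟩
  simp only [Polynomial.eval_add, Polynomial.eval_X]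
  omega

theorem comp (hc : RunsIn c p x y) (hd : RunsIn d q y z) :
    RunsIn (Code.comp c d) (1 + p + q.comp p) x z := by
  have hy := hc.size_le
  obtain ⟨m, h1, h2⟩ := hc
  obtain ⟨n, h3, h4⟩ := hd
  refine ⟨_, Run.comp h1 h3, ?_⟩
  have := natPoly_eval_mono q hy
  simp only [Polynomial.eval_add, Polynomial.eval_one, Polynomial.eval_comp]
  omega

end RunsIn

/-- Types whose elements are represented by trees. -/
class Enc (α : Type) where
  enc : α → Data

open Enc (enc)

/-- The size of the representing tree. -/
def esize {α : Type} [Enc α] (a : α) : ℕ := (enc a).size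

instance : Enc Unit := ⟨fun _ => Data.nil⟩
instance : Enc Bool := ⟨encodeBool⟩
instance {α β : Type} [Enc α] [Enc β] : Enc (α × β) := ⟨fun x => Data.cons (enc x.1) (enc x.2)⟩
instance {α : Type} [Enc α] : Enc (List α) := ⟨fun l => encodeList (l.map enc)⟩
/-- Within programs, natural numbers are represented in unary. -/
instance : Enc ℕ := ⟨fun n => encodeList (List.replicate n Data.nil)⟩

/-- The function `f` is computable in polynomial time. -/
def PT {α β : Type} [Enc α] [Enc β] (f : α → β) : Prop :=
  ∃ (c : Code) (p : Polynomial ℕ), ∀ x, RunsIn c p (enc x) (enc (f x))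

section basic

variable {Γ α β δ : Type} [Enc Γ] [Enc α] [Enc β] [Enc δ]

theorem one_le_esize (a : α) : 1 ≤ esize a := Data.one_le_size _

theorem esize_prod (x : α × β) : esize x = esize x.1 + esize x.2 + 1 := rfl

theorem esize_nil : esize ([] : List α) = 1 := rfl

theorem esize_cons (a : α) (l : List α) : esize (a :: l) = esize a + esize l + 1 := rfl

theorem esize_append (l l' : List α) : esize (l ++ l') + 1 = esize l + esize l' := by
  induction l with
  | nil => simp [esize_nil]; omega
  | cons a l ih => simp only [List.cons_append, esize_cons]; omega

theorem esize_reverse (l : List α) : esize l.reverse = esize l := by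
  induction l with
  | nil => rfl
  | cons a l ih =>
    have := esize_append l.reverse [a]
    simp only [List.reverse_cons, esize_cons, esize_nil] at *
    omega

theorem length_lt_esize (l : List α) : l.length < esize l := by
  induction l with
  | nil => simp [esize_nil]
  | cons a l ih => simp only [List.length_cons, esize_cons]; omega

theorem esize_le_of_mem {a : α} {l : List α} (h : a ∈ l) : esize a ≤ esize l := by
  induction l with
  | nil => simp at h
  | cons b l ih =>
    rw [esize_cons]
    rcases List.mem_cons.1 h with rfl | h
    · omega
    · have := ih h; omega

theorem esize_le_length_mul {l : List α} {B : ℕ} (h : ∀ a ∈ l, esize a ≤ B) :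
    esize l ≤ l.length * (B + 1) + 1 := by
  induction l with
  | nil => simp [esize_nil]
  | cons b l ih =>
    have h1 := ih fun a ha => h a (List.mem_cons_of_mem _ ha)
    have h2 := h b List.mem_cons_self
    rw [esize_cons, List.length_cons, add_mul]
    omega

theorem esize_nat (n : ℕ) : esize n = 2 * n + 1 := by
  induction n with
  | zero => rfl
  | succ n ih => change 1 + esize n + 1 = _; omega

namespace PT

theorem exists_esize_le {f : α → β} (hf : PT f) :
    ∃ p : Polynomial ℕ, ∀ x, esize (f x) ≤ p.eval (esize x) := by
  obtain ⟨c, p, h⟩ := hf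
  exact ⟨p, fun x => (h x).size_le⟩

protected theorem id : PT (fun x : α => x) := ⟨_, _, fun _ => RunsIn.id⟩

theorem comp {g : β → δ} {f : α → β} (hg : PT g) (hf : PT f) : PT (fun x => g (f x)) := by
  obtain ⟨c, p, h⟩ := hf
  obtain ⟨d, q, h'⟩ := hg
  exact ⟨_, _, fun x => (h x).comp (h' _)⟩

/-- Change of representation. -/
theorem congr {f : α → β} {g : α → δ} (hf : PT f) (h : ∀ x, enc (f x) = enc (g x)) : PT g := by
  obtain ⟨c, p, h'⟩ := hf
  exact ⟨c, p, fun x => h x ▸ h' x⟩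

theorem pair {f : Γ → α} {g : Γ → β} (hf : PT f) (hg : PT g) : PT (fun x => (f x, g x)) := by
  obtain ⟨c, p, h⟩ := hf
  obtain ⟨d, q, h'⟩ := hg
  exact ⟨_, _, fun x => (h x).pair (h' x)⟩

theorem fst {f : Γ → α × β} (hf : PT f) : PT (fun x => (f x).1) := by
  obtain ⟨c, p, h⟩ := hf
  exact ⟨_, _, fun x => (h x).comp RunsIn.fst⟩

theorem snd {f : Γ → α × β} (hf : PT f) : PT (fun x => (f x).2) := by
  obtain ⟨c, p, h⟩ := hf
  exact ⟨_, _, fun x => (h x).comp RunsIn.snd⟩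

theorem exists_runsIn_const (y : Data) : ∃ c p, ∀ x, RunsIn c p x y := by
  induction y with
  | nil => exact ⟨_, _, fun x => RunsIn.nil⟩
  | cons a b iha ihb =>
    obtain ⟨c, p, h⟩ := iha
    obtain ⟨d, q, h'⟩ := ihb
    exact ⟨_, _, fun x => (h x).pair (h' x)⟩

theorem const (b : β) : PT (fun _ : α => b) := by
  obtain ⟨c, p, h⟩ := exists_runsIn_const (enc b)
  exact ⟨c, p, fun x => h _⟩

theorem cons {f : Γ → α} {l : Γ → List α} (hf : PT f) (hl : PT l) :
    PT (fun x => f x :: l x) :=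
  (pair hf hl).congr fun _ => rfl

theorem tail {l : Γ → List α} (hl : PT l) : PT (fun x => (l x).tail) := by
  obtain ⟨c, p, h⟩ := hl
  refine ⟨Code.comp c Code.snd, 1 + p + Polynomial.X.comp p, fun x => ?_⟩
  have := (h x).comp RunsIn.snd
  revert this
  beta_reduce
  cases l x <;> exact fun h => h

theorem cond {b : Γ → Bool} {f g : Γ → α} (hb : PT b) (hf : PT f) (hg : PT g) :
    PT (fun x => if b x = true then f x else g x) := by
  obtain ⟨c, p, h⟩ := hb
  obtain ⟨d, q, h'⟩ := hf
  obtain ⟨e, r, h''⟩ := hg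
  -- The branches are swapped because `false` is the leaf, on which `Code.cond` takes its first
  -- branch. The sum `q + r` bounds either branch.
  refine ⟨Code.cond c e d, Polynomial.X + p + (q + r), fun x => ?_⟩
  obtain ⟨n, h1, h2⟩ := h x
  obtain ⟨n', h1', h2'⟩ := h' x
  obtain ⟨n'', h1'', h2''⟩ := h'' x
  cases hbx : b x
  · rw [hbx] at h1
    simp only [RunsIn, hbx]
    refine ⟨_, Run.cond_nil h1 h1'', ?_⟩
    simp only [Polynomial.eval_add, Polynomial.eval_X]; omega
  · rw [hbx] at h1
    simp only [RunsIn, hbx]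
    refine ⟨_, Run.cond_cons h1 h1', ?_⟩
    simp only [Polynomial.eval_add, Polynomial.eval_X]; omega

theorem match_list {l : Γ → List α} {f g : Γ → β} (hl : PT l) (hf : PT f) (hg : PT g) :
    PT (fun x => if (l x).isEmpty = true then f x else g x) := by
  obtain ⟨c, p, h⟩ := hl
  obtain ⟨d, q, h'⟩ := hf
  obtain ⟨e, r, h''⟩ := hg
  refine ⟨Code.cond c d e, Polynomial.X + p + (q + r), fun x => ?_⟩
  obtain ⟨n, h1, h2⟩ := h x
  obtain ⟨n', h1', h2'⟩ := h' x
  obtain ⟨n'', h1'', h2''⟩ := h'' x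
  cases hbx : l x
  · rw [hbx] at h1
    simp only [RunsIn, hbx]
    refine ⟨_, Run.cond_nil h1 h1', ?_⟩
    simp only [Polynomial.eval_add, Polynomial.eval_X]; omega
  · rw [hbx] at h1
    simp only [RunsIn, hbx]
    refine ⟨_, Run.cond_cons h1 h1'', ?_⟩
    simp only [Polynomial.eval_add, Polynomial.eval_X]; omega

theorem isEmpty {l : Γ → List α} (hl : PT l) : PT (fun x => (l x).isEmpty) := by
  convert match_list hl (const true) (const false) using 2 with x
  cases l x <;> rfl

theorem headD {l : Γ → List α} {f : Γ → α} (hl : PT l) (hf : PT f) :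
    PT (fun x => (l x).headD (f x)) := by
  obtain ⟨c, p, h⟩ := hl
  obtain ⟨e, r, h''⟩ := hf
  refine ⟨Code.cond c e (Code.comp c Code.fst),
    Polynomial.X + p + (r + (1 + p + Polynomial.X.comp p)), fun x => ?_⟩
  obtain ⟨n', h1', h2'⟩ := (h x).comp RunsIn.fst
  obtain ⟨n, h1, h2⟩ := h x
  obtain ⟨n'', h1'', h2''⟩ := h'' x
  cases hbx : l x
  · rw [hbx] at h1
    simp only [RunsIn, hbx]
    refine ⟨_, Run.cond_nil h1 h1'', ?_⟩
    simp only [Polynomial.eval_add, Polynomial.eval_X] at *; omega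
  · rw [hbx] at h1 h1'
    simp only [RunsIn, hbx]
    refine ⟨_, Run.cond_cons h1 h1', ?_⟩
    simp only [Polynomial.eval_add, Polynomial.eval_X] at *; omega

/-- The loop state is the triple of environment `g`, accumulator and remaining list. The test
returns the remaining list, which is a leaf exactly when the fold is finished. `B` bounds all
intermediate states, so each round has the same cost bound. -/
theorem exists_run_foldl {c : Code} {p : Polynomial ℕ} (test : Code) (q : Polynomial ℕ)
    {f : β → α → β} (g : Data)
    (htest : ∀ x y z, RunsIn test q (Data.cons x (Data.cons y z)) z)
    (hc : ∀ b a (l : List α), RunsIn c p (Data.cons g (Data.cons (enc b) (enc (a :: l))))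
      (Data.cons g (Data.cons (enc (f b a)) (enc l))))
    (B : ℕ) (l : List α) (b : β)
    (hB : ∀ l', l' <+: l → g.size + esize (l'.foldl f b) + esize l + 2 ≤ B) :
    ∃ n, Run (Code.loop test c) (Data.cons g (Data.cons (enc b) (enc l)))
      (Data.cons g (Data.cons (enc (l.foldl f b)) (enc ([] : List α)))) n ∧
      n ≤ (l.length + 1) * (B + q.eval B + p.eval B) := by
  have hsize : ∀ (b : β) (l : List α), (Data.cons g (Data.cons (enc b) (enc l))).size =
    g.size + esize b + esize l + 2 := fun b l => by
      simp only [Data.size, esize]; omega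
  induction l generalizing b with
  | nil =>
    obtain ⟨n, h1, h2⟩ := htest g (enc b) (enc ([] : List α))
    refine ⟨_, Run.loop_stop h1, ?_⟩
    have h3 := hB [] List.prefix_rfl
    have h4 := natPoly_eval_mono q h3
    rw [hsize] at *
    simp only [List.foldl_nil, List.length_nil] at *
    omega
  | cons a l ih =>
    obtain ⟨n, h1, h2⟩ := htest g (enc b) (enc (a :: l))
    obtain ⟨m, h3, h4⟩ := hc b a l
    obtain ⟨k, h5, h6⟩ := ih (f b a) (fun l' hl' => by
      have := hB (a :: l') (List.cons_prefix_cons.2 ⟨rfl, hl'⟩)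
      rw [List.foldl_cons, esize_cons] at this
      omega)
    refine ⟨_, Run.loop_step h1 h3 h5, ?_⟩
    have h7 := hB [] (List.nil_prefix)
    have h8 := natPoly_eval_mono q h7
    have h9 := natPoly_eval_mono p h7
    rw [hsize] at *
    simp only [List.foldl_nil, List.length_cons] at *
    rw [add_mul _ 1]
    omega

/-- The bound `hq` on all intermediate accumulators is essential: a polynomial-time step that
doubles its accumulator would make the fold exponential. -/
theorem foldl {l : Γ → List α} {b : Γ → β} {f : Γ → β → α → β} (hl : PT l) (hb : PT b)
    (hf : PT (fun x : Γ × β × α => f x.1 x.2.1 x.2.2)) (q : Polynomial ℕ)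
    (hq : ∀ x l', l' <+: l x → esize (l'.foldl (f x) (b x)) ≤ q.eval (esize x)) :
    PT (fun x => (l x).foldl (f x) (b x)) := by
  obtain ⟨pl, hpl⟩ := hl.exists_esize_le
  obtain ⟨ci, pi, hi⟩ := PT.id.pair (hb.pair hl)
  obtain ⟨c, p, h⟩ := hf
  have htest : ∀ x y z, RunsIn (Code.comp Code.snd Code.snd) _ (Data.cons x (Data.cons y z)) z :=
    fun x y z => RunsIn.snd.comp RunsIn.snd
  obtain ⟨cb, qb, hbody⟩ : ∃ cb qb, ∀ (x : Γ) b a (l : List α), RunsIn cb qb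
      (Data.cons (enc x) (Data.cons (enc b) (enc (a :: l))))
      (Data.cons (enc x) (Data.cons (enc (f x b a)) (enc l))) := ⟨_, _, fun x b a l =>
    RunsIn.fst.pair ((((RunsIn.fst.pair ((RunsIn.snd.comp RunsIn.fst).pair
      ((RunsIn.snd.comp RunsIn.snd).comp RunsIn.fst)))).comp (h (x, b, a))).pair
      ((RunsIn.snd.comp RunsIn.snd).comp RunsIn.snd))⟩
  generalize (1 + Polynomial.X + Polynomial.X.comp Polynomial.X : Polynomial ℕ) = qt at htest
  let B : Polynomial ℕ := Polynomial.X + q + pl + 2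
  let T : Polynomial ℕ := pl * (B + qt.comp B + qb.comp B)
  -- `T` occurs three times: once for the loop and once for each of the two projections extracting
  -- the accumulator, since the final state is no larger than the loop's step count.
  refine ⟨Code.comp ci (Code.comp (Code.loop (Code.comp Code.snd Code.snd) cb)
    (Code.comp Code.snd Code.fst)), 1 + pi + (1 + T + (1 + T + T)), fun x => ?_⟩
  obtain ⟨n, h1, h2⟩ := hi x
  obtain ⟨m, h3, h4⟩ := exists_run_foldl _ qt (enc x) htest (hbody x) (B.eval (esize x)) (l x) (b x)
    (fun l' hl' => by
      have := hq x l' hl'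
      have := hpl x
      simp only [B, Polynomial.eval_add, Polynomial.eval_X, Polynomial.eval_ofNat]
      unfold esize at *
      omega)
  have h5 : m ≤ T.eval (esize x) := by
    refine h4.trans ?_
    simp only [T, Polynomial.eval_mul, Polynomial.eval_add, Polynomial.eval_comp]
    gcongr
    exact (length_lt_esize (l x)).trans_le (hpl x)
  have h6 := h3.size_le
  have h7 : Run (Code.comp Code.snd Code.fst) _ (enc ((l x).foldl (f x) (b x))) _ :=
    Run.comp (Run.snd (Data.cons (enc x) (Data.cons (enc ((l x).foldl (f x) (b x)))
      (enc ([] : List α))))) (Run.fst _)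
  refine ⟨_, Run.comp h1 (Run.comp h3 h7), ?_⟩
  have h8 := Data.size_snd_le (Data.cons (enc x) (Data.cons (enc ((l x).foldl (f x) (b x)))
      (enc ([] : List α))))
  simp only [Polynomial.eval_add, Polynomial.eval_one]
  change n ≤ pi.eval (esize x) at h2
  change _ ≤ 1 + pi.eval (esize x) + (1 + T.eval (esize x) + (1 + T.eval (esize x) + T.eval (esize x)))
  omega

end PT
end basic

attribute [fun_prop] PT
attribute [fun_prop] PT.id PT.comp PT.pair PT.fst PT.snd PT.const PT.cons PT.tail PT.cond
  PT.isEmpty PT.headD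

/-! ### List operations in polynomial time -/

theorem foldl_cons_eq {α : Type} (l l' : List α) : l.foldl (fun acc a => a :: acc) l' = l.reverse ++ l' := by
  induction l generalizing l' with
  | nil => rfl
  | cons a l ih => simp [ih]

theorem foldl_append_eq {α β : Type} (f : α → List β) (l : List α) (l' : List β) :
    l.foldl (fun acc a => f a ++ acc) l' = l.reverse.flatMap f ++ l' := by
  induction l generalizing l' with
  | nil => rfl
  | cons a l ih => simp [ih]

theorem foldl_tail {α : Type} (l : List α) (n : ℕ) :
    (List.replicate n ()).foldl (fun m _ => m.tail) l = l.drop n := by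
  induction n generalizing l with
  | zero => rfl
  | succ n ih => rw [List.replicate_succ, List.foldl_cons, ih, List.drop_tail]

theorem esize_flatMap_le {α β : Type} [Enc β] {l : List α} {f : α → List β} {B : ℕ} (h : ∀ a ∈ l, esize (f a) ≤ B) :
    esize (l.flatMap f) ≤ l.length * B + 1 := by
  induction l with
  | nil => simp [esize_nil]
  | cons b l ih =>
    have h1 := ih fun a ha => h a (List.mem_cons_of_mem _ ha)
    have h2 := h b List.mem_cons_self
    have h3 := esize_append (f b) (l.flatMap f)
    rw [List.flatMap_cons, List.length_cons, add_mul]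
    omega

/-- All lists of length `n` with entries from `l`. -/
def tuples {α : Type} : ℕ → List α → List (List α)
  | 0, _ => [[]]
  | n + 1, l => l.flatMap fun a => (tuples n l).map fun m => a :: m

theorem mem_tuples {α : Type} {n : ℕ} {l m : List α} : m ∈ tuples n l ↔ m.length = n ∧ ∀ a ∈ m, a ∈ l := by
  induction n generalizing m with
  | zero => cases m <;> simp [tuples]
  | succ n ih => cases m <;> simp [tuples, ih]; tauto

section lists

variable {Γ α β δ : Type} [Enc Γ] [Enc α] [Enc β] [Enc δ]

theorem esize_le_of_isPrefix {l l' : List α} (h : l' <+: l) : esize l' ≤ esize l := by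
  obtain ⟨m, rfl⟩ := h
  have := esize_append l' m
  have := one_le_esize m
  omega

namespace PT

@[fun_prop]
theorem reverse {l : Γ → List α} (hl : PT l) : PT (fun x => (l x).reverse) := by
  obtain ⟨p, hp⟩ := hl.exists_esize_le
  have : PT (fun x => (l x).foldl (fun acc a => a :: acc) []) := by
    refine foldl (f := fun _ acc a => a :: acc) hl (const _) (by fun_prop) p fun x l' h => ?_
    rw [foldl_cons_eq, List.append_nil, esize_reverse]
    exact (esize_le_of_isPrefix h).trans (hp x)
  simpa only [foldl_cons_eq, List.append_nil] using this

@[fun_prop]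
theorem append {l l' : Γ → List α} (hl : PT l) (hl' : PT l') : PT (fun x => l x ++ l' x) := by
  obtain ⟨p, hp⟩ := hl.exists_esize_le
  obtain ⟨p', hp'⟩ := hl'.exists_esize_le
  have : PT (fun x => (l x).reverse.foldl (fun acc a => a :: acc) (l' x)) := by
    refine foldl (f := fun _ acc a => a :: acc) hl.reverse hl' (by fun_prop) (p + p')
      fun x m h => ?_
    have h1 := esize_append m.reverse (l' x)
    have h2 := esize_le_of_isPrefix h
    rw [esize_reverse] at h1 h2
    rw [foldl_cons_eq, Polynomial.eval_add]
    have := hp x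
    have := hp' x
    omega
  simpa only [foldl_cons_eq, List.reverse_reverse] using this

@[fun_prop]
theorem flatMap {l : Γ → List α} {f : Γ → α → List β} (hl : PT l)
    (hf : PT (fun x : Γ × α => f x.1 x.2)) : PT (fun x => (l x).flatMap (f x)) := by
  obtain ⟨p, hp⟩ := hl.exists_esize_le
  obtain ⟨q, hq⟩ := hf.exists_esize_le
  have : PT (fun x => (l x).reverse.foldl (fun acc a => f x a ++ acc) []) := by
    have h1 : PT (fun y : Γ × List β × α => f y.1 y.2.2) :=
      comp (f := fun y : Γ × List β × α => (y.1, y.2.2)) hf (by fun_prop)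
    refine foldl (f := fun x acc a => f x a ++ acc) hl.reverse (const _)
      (by fun_prop) (p * q.comp (Polynomial.X + p + 1) + 1) fun x m h => ?_
    have h2 := length_lt_esize m
    have h3 := esize_le_of_isPrefix h
    rw [esize_reverse] at h3
    have h4 := hp x
    rw [foldl_append_eq, List.append_nil]
    simp only [Polynomial.eval_add, Polynomial.eval_mul, Polynomial.eval_comp, Polynomial.eval_one,
      Polynomial.eval_X]
    refine (esize_flatMap_le (B := q.eval (esize x + p.eval (esize x) + 1)) fun a ha => ?_).trans ?_
    · refine (hq (x, a)).trans (natPoly_eval_mono _ ?_)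
      rw [esize_prod]
      have : a ∈ l x := by simpa using h.subset (by simpa using ha)
      have := esize_le_of_mem this
      dsimp only
      omega
    · rw [List.length_reverse]
      gcongr
      omega
  simpa only [foldl_append_eq, List.append_nil, List.reverse_reverse] using this

@[fun_prop]
theorem map {l : Γ → List α} {f : Γ → α → β} (hl : PT l)
    (hf : PT (fun x : Γ × α => f x.1 x.2)) : PT (fun x => (l x).map (f x)) := by
  have : PT (fun x => (l x).flatMap (fun a => [f x a])) := by fun_prop
  simpa only [List.map_eq_flatMap] using this

@[fun_prop]
theorem filter {l : Γ → List α} {f : Γ → α → Bool} (hl : PT l)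
    (hf : PT (fun x : Γ × α => f x.1 x.2)) : PT (fun x => (l x).filter (f x)) := by
  have : PT (fun x => (l x).flatMap (fun a => if f x a = true then [a] else [])) := by fun_prop
  convert this using 2 with x
  induction l x with
  | nil => rfl
  | cons a l ih => cases h : f x a <;> simp [h, ih]

@[fun_prop]
theorem not {f : Γ → Bool} (hf : PT f) : PT (fun x => !(f x)) := by
  convert cond hf (const false) (const true) using 2 with x
  cases f x <;> rfl

@[fun_prop]
theorem and {f g : Γ → Bool} (hf : PT f) (hg : PT g) : PT (fun x => f x && g x) := by
  convert cond hf hg (const false) using 2 with x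
  cases f x <;> rfl

@[fun_prop]
theorem or {f g : Γ → Bool} (hf : PT f) (hg : PT g) : PT (fun x => f x || g x) := by
  convert cond hf (const true) hg using 2 with x
  cases f x <;> rfl

@[fun_prop]
theorem any {l : Γ → List α} {f : Γ → α → Bool} (hl : PT l)
    (hf : PT (fun x : Γ × α => f x.1 x.2)) : PT (fun x => (l x).any (f x)) := by
  have : PT (fun x => !((l x).filter (f x)).isEmpty) := by fun_prop
  convert this using 2 with x
  rw [Bool.eq_iff_iff]
  simp

@[fun_prop]
theorem all {l : Γ → List α} {f : Γ → α → Bool} (hl : PT l)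
    (hf : PT (fun x : Γ × α => f x.1 x.2)) : PT (fun x => (l x).all (f x)) := by
  have : PT (fun x => !((l x).any (fun a => !(f x a)))) := by fun_prop
  convert this using 2 with x
  rw [Bool.eq_iff_iff]
  simp

/-- Here `l` is fixed, not part of the input, so each entry may have its own program and its own
polynomial. This is needed where an entry serves as the length of tuples. -/
theorem any_const {ι : Type} (l : List ι) {f : Γ → ι → Bool} (hf : ∀ i, PT (fun x => f x i)) :
    PT (fun x => l.any (f x)) := by
  induction l with
  | nil => exact const _
  | cons a l ih => exact or (hf a) ih

theorem flatMap_const {ι : Type} (l : List ι) {f : Γ → ι → List α}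
    (hf : ∀ i, PT (fun x => f x i)) : PT (fun x => l.flatMap (f x)) := by
  induction l with
  | nil => exact const _
  | cons a l ih => exact append (hf a) ih

end PT

@[fun_prop]
-- The length `n` has to be a constant: it is the exponent in the number of tuples, and the program
-- is built by recursion on it.
theorem PT.tuples (n : ℕ) {l : Γ → List α} (hl : PT l) : PT (fun x => tuples n (l x)) := by
  suffices PT (fun m : List α => PackingKernel.tuples n m) from this.comp hl
  induction n with
  | zero => exact const _
  | succ n ih =>
    have h : PT (fun y : List α × α => PackingKernel.tuples n y.1) := comp ih (by fun_prop)
    simp only [PackingKernel.tuples]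
    fun_prop

/-- Go through the list `l` and collect the elements that pass the test `p`, which may depend on
the elements collected so far. -/
def greedy (p : List α → α → Bool) (l : List α) : List α :=
  l.foldl (fun acc a => if p acc a = true then a :: acc else acc) []

theorem esize_foldl_ite_le (p : List α → α → Bool) (l l' : List α) :
    esize (l.foldl (fun acc a => if p acc a = true then a :: acc else acc) l') ≤
      esize l + esize l' := by
  induction l generalizing l' with
  | nil => exact Nat.le_add_left _ _
  | cons a l ih =>
    rw [List.foldl_cons, esize_cons]
    refine (ih _).trans ?_
    split
    · rw [esize_cons]; omega
    · omega

@[fun_prop]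
theorem PT.greedy {l : Γ → List α} {f : Γ → List α → α → Bool} (hl : PT l)
    (hf : PT (fun x : Γ × List α × α => f x.1 x.2.1 x.2.2)) :
    PT (fun x => greedy (f x) (l x)) := by
  obtain ⟨p, hp⟩ := hl.exists_esize_le
  refine foldl (f := fun x acc a => if f x acc a = true then a :: acc else acc) hl (const _)
    (by fun_prop) (p + 1) fun x l' h => ?_
  have := esize_foldl_ite_le (f x) l' []
  have := esize_le_of_isPrefix h
  have := hp x
  rw [esize_nil] at *
  rw [Polynomial.eval_add, Polynomial.eval_one]
  omega

end lists

/-! ### Unary arithmetic and unordered pairs in polynomial time -/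

section numbers

variable {Γ α : Type} [Enc Γ] [Enc α]

namespace PT

@[fun_prop]
theorem length {l : Γ → List α} (hl : PT l) : PT (fun x => (l x).length) := by
  have : PT (fun x => (l x).map fun _ => ()) := by fun_prop
  refine this.congr fun x => ?_
  change encodeList _ = encodeList _
  rw [List.map_map]
  exact congrArg _ (List.eq_replicate_iff.2 ⟨by simp, by simp [enc]⟩)

@[fun_prop]
theorem replicate {f : Γ → ℕ} (hf : PT f) : PT (fun x => List.replicate (f x) ()) :=
  hf.congr fun x => by
    change encodeList _ = encodeList _
    rw [List.map_replicate]
    rfl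

@[fun_prop]
theorem add {f g : Γ → ℕ} (hf : PT f) (hg : PT g) : PT (fun x => f x + g x) := by
  have : PT (fun x => (List.replicate (f x) () ++ List.replicate (g x) ()).length) := by fun_prop
  simpa using this

@[fun_prop]
theorem mul {f g : Γ → ℕ} (hf : PT f) (hg : PT g) : PT (fun x => f x * g x) := by
  have : PT (fun x => ((List.replicate (f x) ()).flatMap
      (fun _ => List.replicate (g x) ())).length) := by fun_prop
  simpa using this

@[fun_prop]
theorem pow {f : Γ → ℕ} (hf : PT f) (n : ℕ) : PT (fun x => f x ^ n) := by
  induction n with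
  | zero => exact const _
  | succ n ih => simp only [pow_succ]; fun_prop

@[fun_prop]
theorem drop {f : Γ → ℕ} {l : Γ → List α} (hf : PT f) (hl : PT l) :
    PT (fun x => (l x).drop (f x)) := by
  obtain ⟨p, hp⟩ := hl.exists_esize_le
  have : PT (fun x => (List.replicate (f x) ()).foldl (fun m _ => m.tail) (l x)) := by
    refine foldl (l := fun x => List.replicate (f x) ()) (f := fun _ m (_ : Unit) => m.tail) (by fun_prop) hl (by fun_prop) p fun x l' h => ?_
    rw [List.eq_replicate_of_mem (l := l') (a := ()) (by simp), foldl_tail]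
    refine le_trans ?_ (hp x)
    have h1 := esize_append ((l x).take l'.length) ((l x).drop l'.length)
    rw [List.take_append_drop] at h1
    have := one_le_esize ((l x).take l'.length)
    omega
  simpa only [foldl_tail] using this

@[fun_prop]
theorem getD {f : Γ → ℕ} {l : Γ → List α} {d : Γ → α} (hl : PT l) (hf : PT f) (hd : PT d) :
    PT (fun x => (l x).getD (f x) (d x)) := by
  have : PT (fun x => ((l x).drop (f x)).headD (d x)) := by fun_prop
  convert this using 2 with x
  simp [List.headD_eq_head?_getD]

@[fun_prop]
theorem range {f : Γ → ℕ} (hf : PT f) : PT (fun x => List.range (f x)) := by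
  obtain ⟨p, hp⟩ := hf.exists_esize_le
  have key : ∀ n : ℕ, (List.replicate n ()).foldl (fun m _ => m.length :: m) [] =
      (List.range n).reverse := by
    intro n
    induction n with
    | zero => rfl
    | succ n ih => simp [List.replicate_succ', ih, List.range_succ]
  have : PT (fun x => ((List.replicate (f x) ()).foldl (fun m _ => m.length :: m) []).reverse) := by
    refine reverse (foldl (l := fun x => List.replicate (f x) ()) (f := fun _ m (_ : Unit) => m.length :: m) (by fun_prop) (const _)
      (by fun_prop) (p * (p + 1) + 1) fun x l' h => ?_)
    have h1 : l'.length ≤ f x := by simpa using h.length_le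
    rw [List.eq_replicate_of_mem (l := l') (a := ()) (by simp), key, esize_reverse]
    have h2 := hp x
    have h3 := esize_nat (f x)
    refine (esize_le_length_mul (B := p.eval (esize x)) fun a ha => ?_).trans ?_
    · rw [List.mem_range] at ha
      have := esize_nat a
      omega
    · simp only [Polynomial.eval_add, Polynomial.eval_mul, Polynomial.eval_one, List.length_range]
      gcongr
      omega
  simpa only [key, List.reverse_reverse] using this

end PT

/-- `a ≤ b` as a test. -/
def leB (a b : ℕ) : Bool := decide (a ≤ b)

@[simp] theorem leB_iff {a b : ℕ} : leB a b = true ↔ a ≤ b := decide_eq_true_iff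

@[fun_prop]
theorem PT.leB {f g : Γ → ℕ} (hf : PT f) (hg : PT g) : PT (fun x => leB (f x) (g x)) := by
  have : PT (fun x => ((List.replicate (f x) ()).drop (g x)).isEmpty) := by fun_prop
  convert this using 2 with x
  rw [Bool.eq_iff_iff]
  simp [Nat.sub_eq_zero_iff_le]

@[fun_prop]
theorem PT.nat_min {f g : Γ → ℕ} (hf : PT f) (hg : PT g) : PT (fun x => min (f x) (g x)) := by
  have : PT (fun x => if PackingKernel.leB (f x) (g x) = true then f x else g x) := by fun_prop
  simpa only [PackingKernel.leB_iff, ← min_def] using this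

@[fun_prop]
theorem PT.nat_max {f g : Γ → ℕ} (hf : PT f) (hg : PT g) : PT (fun x => max (f x) (g x)) := by
  have : PT (fun x => if PackingKernel.leB (f x) (g x) = true then g x else f x) := by fun_prop
  simpa only [PackingKernel.leB_iff, ← max_def] using this

/-- Equality as a test. -/
def eqB [DecidableEq α] (a b : α) : Bool := decide (a = b)

@[simp] theorem eqB_iff {α : Type} [DecidableEq α] {a b : α} : eqB a b = true ↔ a = b := decide_eq_true_iff

/-- Types for which equality can be tested in polynomial time. -/
class EqPT (α : Type) [Enc α] [DecidableEq α] : Prop where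
  eqB : PT (fun x : α × α => eqB x.1 x.2)

@[fun_prop]
theorem PT.eqB [DecidableEq α] [EqPT α] {f g : Γ → α} (hf : PT f) (hg : PT g) :
    PT (fun x => eqB (f x) (g x)) :=
  comp (f := fun x => (f x, g x)) EqPT.eqB (hf.pair hg)

instance : EqPT ℕ where
  eqB := by
    have : PT (fun x : ℕ × ℕ => leB x.1 x.2 && leB x.2 x.1) := by fun_prop
    convert this using 2 with x
    rw [Bool.eq_iff_iff, eqB_iff, le_antisymm_iff]
    simp

/-- An unordered pair of numbers is represented by the ordered one. -/
instance : Enc (Sym2 ℕ) := ⟨fun e => enc (e.inf, e.sup)⟩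

@[fun_prop]
theorem PT.sym2_mk {f g : Γ → ℕ} (hf : PT f) (hg : PT g) : PT (fun x => s(f x, g x)) := by
  have : PT (fun x => (min (f x) (g x), max (f x) (g x))) := by fun_prop
  exact this.congr fun x => rfl

@[fun_prop]
theorem PT.sym2_inf {f : Γ → Sym2 ℕ} (hf : PT f) : PT (fun x => (f x).inf) := by
  have : PT (fun x => ((f x).inf, (f x).sup)) := hf.congr fun x => rfl
  exact this.fst

@[fun_prop]
theorem PT.sym2_sup {f : Γ → Sym2 ℕ} (hf : PT f) : PT (fun x => (f x).sup) := by
  have : PT (fun x => ((f x).inf, (f x).sup)) := hf.congr fun x => rfl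
  exact this.snd

instance : EqPT (Sym2 ℕ) where
  eqB := by
    have : PT (fun x : Sym2 ℕ × Sym2 ℕ => PackingKernel.eqB x.1.inf x.2.inf &&
      PackingKernel.eqB x.1.sup x.2.sup) := by fun_prop
    convert this using 2 with x
    rw [Bool.eq_iff_iff]
    simp [Sym2.inf_eq_inf_and_sup_eq_sup]

end numbers

/-! ### Finite sets represented by lists -/

section sets

variable {Γ α : Type} [Enc Γ] [Enc α] [DecidableEq α] [EqPT α]

/-- Membership as a test. -/
def memB (a : α) (l : List α) : Bool := l.any fun b => eqB a b

/-- Inclusion of the sets represented by two lists as a test. -/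
def subB (l m : List α) : Bool := l.all fun a => memB a m

/-- Equality of the sets represented by two lists as a test. -/
def seteqB (l m : List α) : Bool := subB l m && subB m l

/-- The list without repetitions. -/
def nub (l : List α) : List α := greedy (fun acc a => !memB a acc) l

omit [Enc α] [EqPT α]

@[simp] theorem memB_iff {a : α} {l : List α} : memB a l = true ↔ a ∈ l := by
  simp [memB]

@[simp] theorem subB_iff {l m : List α} : subB l m = true ↔ l.toFinset ⊆ m.toFinset := by
  simp [subB, Finset.subset_iff]

@[simp] theorem seteqB_iff {l m : List α} : seteqB l m = true ↔ l.toFinset = m.toFinset := by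
  simp [seteqB, Finset.Subset.antisymm_iff]

theorem nub_aux (l l' : List α) (h : l'.Nodup) :
    (l.foldl (fun acc a => if (!memB a acc) = true then a :: acc else acc) l').Nodup ∧
    (l.foldl (fun acc a => if (!memB a acc) = true then a :: acc else acc) l').toFinset =
      l'.toFinset ∪ l.toFinset := by
  induction l generalizing l' with
  | nil => simp [h]
  | cons a l ih =>
    rw [List.foldl_cons]
    by_cases ha : a ∈ l'
    · simp only [memB_iff.2 ha, Bool.not_true, Bool.false_eq_true, ↓reduceIte]
      refine ⟨(ih l' h).1, (ih l' h).2.trans ?_⟩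
      ext b
      simp only [Finset.mem_union, List.mem_toFinset, List.mem_cons]
      grind
    · have hf : memB a l' = false := Bool.eq_false_iff.2 (mt memB_iff.1 ha)
      simp only [hf, Bool.not_false, ↓reduceIte]
      have h2 := ih (a :: l') (List.nodup_cons.2 ⟨ha, h⟩)
      refine ⟨h2.1, h2.2.trans ?_⟩
      ext b
      simp only [Finset.mem_union, List.mem_toFinset, List.mem_cons]
      grind

theorem nodup_nub (l : List α) : (nub l).Nodup := (nub_aux l [] List.nodup_nil).1

@[simp] theorem toFinset_nub (l : List α) : (nub l).toFinset = l.toFinset :=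
  (nub_aux l [] List.nodup_nil).2.trans (by simp)

@[simp] theorem length_nub (l : List α) : (nub l).length = l.toFinset.card := by
  rw [← toFinset_nub, List.toFinset_card_of_nodup (nodup_nub l)]

variable [Enc α] [EqPT α]

namespace PT

@[fun_prop]
theorem memB {f : Γ → α} {l : Γ → List α} (hf : PT f) (hl : PT l) :
    PT (fun x => memB (f x) (l x)) := by
  unfold PackingKernel.memB; fun_prop

@[fun_prop]
theorem subB {l m : Γ → List α} (hl : PT l) (hm : PT m) : PT (fun x => subB (l x) (m x)) := by
  unfold PackingKernel.subB; fun_prop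

@[fun_prop]
theorem seteqB {l m : Γ → List α} (hl : PT l) (hm : PT m) :
    PT (fun x => seteqB (l x) (m x)) := by
  unfold PackingKernel.seteqB; fun_prop

@[fun_prop]
theorem nub {l : Γ → List α} (hl : PT l) : PT (fun x => nub (l x)) := by
  unfold PackingKernel.nub; fun_prop

end PT

end sets

/-! ## Packing sets with bounded overlap -/

/-- There are `k` sets in the family `S`, any two of which have at most `t` elements in common. -/
def SetPack {α : Type} [DecidableEq α] (t k : ℕ) (S : Set (Finset α)) : Prop :=
  ∃ K : Finset (Finset α), k ≤ K.card ∧ (∀ A ∈ K, A ∈ S) ∧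
    ∀ A ∈ K, ∀ B ∈ K, A ≠ B → (A ∩ B).card ≤ t

section setPacking

variable {α : Type} [DecidableEq α] {r t k : ℕ} {S : Set (Finset α)} {M : Finset (Finset α)}

theorem SetPack.mono {S' : Set (Finset α)} (h : SetPack t k S) (hS : S ⊆ S') :
    SetPack t k S' := by
  obtain ⟨K, h1, h2, h3⟩ := h
  exact ⟨K, h1, fun A hA => hS (h2 A hA), h3⟩

theorem SetPack.le_card {P : Finset (Finset α)} (h : SetPack t k S) (hS : S ⊆ P) : k ≤ P.card := by
  obtain ⟨K, h1, h2, -⟩ := h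
  exact h1.trans (Finset.card_le_card fun A hA => hS (h2 A hA))

/-- If no more than `(r * k) ^ (r - 1 - Q.card)` members of `M` contain the set `Q`, and equality
holds for `Q`, then a set of the packing that contains `Q` can be replaced by a member of `M`. -/
theorem exists_replacement (hSr : ∀ A ∈ S, A.card ≤ r)
    (hcap : ∀ Q : Finset α, t + 1 ≤ Q.card → Q.card + 1 ≤ r →
      (M.filter (Q ⊆ ·)).card ≤ (r * k) ^ (r - 1 - Q.card))
    {K : Finset (Finset α)} (hK : K.card = k) (hKS : ∀ A ∈ K, A ∈ S)
    (hKt : ∀ A ∈ K, ∀ B ∈ K, A ≠ B → (A ∩ B).card ≤ t) {A : Finset α} (hA : A ∈ K)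
    {Q : Finset α} (hQA : Q ⊆ A) (hQt : t + 1 ≤ Q.card) (hQr : Q.card + 2 ≤ r)
    (hQ : (r * k) ^ (r - 1 - Q.card) ≤ (M.filter (Q ⊆ ·)).card) :
    ∃ B ∈ M, Q ⊆ B ∧ ∀ D ∈ K.erase A, (B ∩ D).card ≤ t := by
  by_contra! hcon
  -- A member `B ⊇ Q` obstructed by `D` meets `D` in more elements than `Q` does, because `Q ∩ D ⊆ A
  -- ∩ D`. So `B` contains `Q` together with some `b ∈ D \ Q`, and such `B` are few by the bound for
  -- `insert b Q`.
  have hsub : M.filter (Q ⊆ ·) ⊆ (K.erase A).biUnion fun D => (D \ Q).biUnion fun b =>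
      M.filter (insert b Q ⊆ ·) := by
    intro B hB
    rw [Finset.mem_filter] at hB
    obtain ⟨D, hD, hlt⟩ := hcon B hB.1 hB.2
    have hQD : (Q ∩ D).card ≤ t :=
      (Finset.card_le_card (Finset.inter_subset_inter_right hQA)).trans
        (hKt A hA D (Finset.mem_of_mem_erase hD) (Finset.ne_of_mem_erase hD).symm)
    obtain ⟨b, hb, hb'⟩ := Finset.exists_mem_notMem_of_card_lt_card (hQD.trans_lt hlt)
    rw [Finset.mem_inter] at hb hb'
    simp only [Finset.mem_biUnion, Finset.mem_filter, Finset.mem_sdiff]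
    exact ⟨D, hD, b, ⟨hb.2, fun h => hb' ⟨h, hb.2⟩⟩, hB.1, Finset.insert_subset hb.1 hB.2⟩
  have hk : 0 < k := hK ▸ Finset.card_pos.2 ⟨A, hA⟩
  have h1 : (M.filter (Q ⊆ ·)).card ≤ (k - 1) * (r * (r * k) ^ (r - 1 - Q.card - 1)) := by
    refine (Finset.card_le_card hsub).trans ((Finset.card_biUnion_le_card_mul _ _ _ ?_).trans
      (le_of_eq (congrArg (· * _) (by rw [Finset.card_erase_of_mem hA, hK]))))
    intro D hD
    refine (Finset.card_biUnion_le_card_mul _ _ ((r * k) ^ (r - 1 - Q.card - 1)) ?_).trans ?_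
    · intro b hb
      have hc : (insert b Q).card = Q.card + 1 :=
        Finset.card_insert_of_notMem (Finset.mem_sdiff.1 hb).2
      have := hcap (insert b Q) (by omega) (by omega)
      rwa [hc, ← Nat.sub_sub] at this
    · gcongr
      exact (Finset.card_le_card Finset.sdiff_subset).trans
        (hSr D (hKS D (Finset.mem_of_mem_erase hD)))
  obtain ⟨e, he⟩ : ∃ e, r - 1 - Q.card = e + 1 := ⟨r - 1 - Q.card - 1, by omega⟩
  rw [he] at hQ h1
  have h2 : 0 < (r * k) ^ e := Nat.pow_pos (Nat.mul_pos (by omega) hk)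
  have h3 : (k - 1) * (r * (r * k) ^ e) < (r * k) ^ (e + 1) := by
    obtain ⟨k, rfl⟩ : ∃ j, k = j + 1 := ⟨k - 1, by omega⟩
    rw [pow_succ, Nat.add_sub_cancel]
    have hr : 0 < r := by omega
    nlinarith [Nat.mul_pos hr h2]
  rw [Nat.add_sub_cancel] at h1
  omega

/-- Exchanging a packing member for one in `M` works as long as its saturated core `Q` has at most
`r - 2` elements. A core with `r - 1` elements leaves room for just one more element, which is the
exceptional form in the conclusion. -/
theorem SetPack.exists_near (hSr : ∀ A ∈ S, A.card ≤ r) (hMS : ∀ A ∈ M, A ∈ S)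
    (hcap : ∀ Q : Finset α, t + 1 ≤ Q.card → Q.card + 1 ≤ r →
      (M.filter (Q ⊆ ·)).card ≤ (r * k) ^ (r - 1 - Q.card))
    (hrej : ∀ A ∈ S, A ∉ M → ∃ Q ⊆ A, t + 1 ≤ Q.card ∧ Q.card + 1 ≤ r ∧
      (r * k) ^ (r - 1 - Q.card) ≤ (M.filter (Q ⊆ ·)).card)
    (hk : 0 < k) (h : SetPack t k S) :
    ∃ K : Finset (Finset α), K.card = k ∧ (∀ A ∈ K, A ∈ S) ∧
      (∀ A ∈ K, ∀ B ∈ K, A ≠ B → (A ∩ B).card ≤ t) ∧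
      ∀ A ∈ K, A ⊆ M.biUnion id ∨ ∃ Q o, Q.card + 1 = r ∧ (∃ B ∈ M, Q ⊆ B) ∧
        o ∉ M.biUnion id ∧ A = insert o Q := by
  obtain ⟨K, h1, h2, h3⟩ := h
  obtain ⟨K', hK', hc⟩ := Finset.exists_subset_card_eq h1
  have h2' : ∀ A ∈ K', A ∈ S := fun A hA => h2 A (hK' hA)
  have h3' : ∀ A ∈ K', ∀ B ∈ K', A ≠ B → (A ∩ B).card ≤ t :=
    fun A hA B hB => h3 A (hK' hA) B (hK' hB)
  clear hK' h1 h2 h3 K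
  -- Every exchange lowers the number of packing members outside `M`.
  induction hd : (K' \ M).card using Nat.strong_induction_on generalizing K' with
  | _ d ih =>
  by_contra! hcon
  obtain ⟨A, hA, hAV, hAQ⟩ := hcon K' hc h2' h3'
  have hAM : A ∉ M := fun hAM => hAV (Finset.subset_biUnion_of_mem id hAM)
  obtain ⟨Q, hQA, hQt, hQr, hQ⟩ := hrej A (h2' A hA) hAM
  have hpos : 0 < (r * k) ^ (r - 1 - Q.card) := Nat.pow_pos (Nat.mul_pos (by omega) hk)
  by_cases hQr' : Q.card + 1 = r
  · obtain ⟨B, hB⟩ := Finset.card_pos.1 (hpos.trans_le hQ)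
    rw [Finset.mem_filter] at hB
    obtain ⟨o, ho, hoV⟩ := Finset.not_subset.1 hAV
    have hoQ : o ∉ Q := fun h => hoV (Finset.mem_biUnion.2 ⟨B, hB.1, hB.2 h⟩)
    refine hAQ Q o hQr' ⟨B, hB⟩ hoV (Finset.eq_of_subset_of_card_le
      (Finset.insert_subset ho hQA) ?_).symm
    rw [Finset.card_insert_of_notMem hoQ, hQr']
    exact hSr A (h2' A hA)
  · obtain ⟨B, hBM, hQB, hB⟩ := exists_replacement hSr hcap hc h2' h3' hA hQA hQt (by omega) hQ
    -- The packing keeps its size: were `B` already another member, it would meet itself in at most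
    -- `t` elements, although it contains `Q`.
    have hBK : B ∉ K'.erase A := fun h => by
      have h4 := hB B h
      have h5 := Finset.card_le_card hQB
      rw [Finset.inter_self] at h4
      omega
    refine absurd (ih ((insert B (K'.erase A)) \ M).card ?_ (insert B (K'.erase A)) ?_ ?_ ?_ rfl)
      (by push Not; exact hcon)
    · rw [← hd]
      refine Finset.card_lt_card (Finset.ssubset_iff_of_subset ?_ |>.2
        ⟨A, Finset.mem_sdiff.2 ⟨hA, hAM⟩, ?_⟩)
      · intro D hD
        simp only [Finset.mem_sdiff, Finset.mem_insert, Finset.mem_erase] at hD ⊢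
        grind
      · simp only [Finset.mem_sdiff, Finset.mem_insert, Finset.mem_erase]
        grind
    · rw [Finset.card_insert_of_notMem hBK, Finset.card_erase_of_mem hA]
      omega
    · intro D hD
      rcases Finset.mem_insert.1 hD with rfl | hD
      · exact hMS _ hBM
      · exact h2' D (Finset.mem_of_mem_erase hD)
    · intro D hD E hE hDE
      rcases Finset.mem_insert.1 hD with hD | hD <;> rcases Finset.mem_insert.1 hE with hE | hE
      · exact absurd (hD.trans hE.symm) hDE
      · rw [hD]; exact hB E hE
      · rw [hE, Finset.inter_comm]; exact hB D hD
      · exact h3' D (Finset.mem_of_mem_erase hD) E (Finset.mem_of_mem_erase hE) hDE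

/-- An assignment of elements outside of `V` to sets in `C` such as an auction delivers it:
`cur Q` is the element that `Q` holds at the end, and `lev Q` is its final price. -/
structure IsAuction (C : Finset (Finset α)) (N : ℕ) (adj : Finset α → α → Prop)
    (cur : Finset α → Option α) (lev : Finset α → ℕ) : Prop where
  card_le : C.card ≤ N
  adj_cur : ∀ Q ∈ C, ∀ o, cur Q = some o → adj Q o
  lev_le : ∀ Q ∈ C, lev Q ≤ N + 1
  exists_cur : ∀ Q ∈ C, 0 < lev Q → ∃ o, cur Q = some o
  inj : ∀ Q ∈ C, ∀ Q' ∈ C, ∀ o, cur Q = some o → cur Q' = some o → Q = Q'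
  lev_le_succ : ∀ Q ∈ C, ∀ o, cur Q = some o → ∀ Q' ∈ C, adj Q' o → lev Q ≤ lev Q' + 1
  lev_of_free : ∀ o, (∀ Q ∈ C, cur Q ≠ some o) → ∀ Q ∈ C, adj Q o → N + 1 ≤ lev Q

omit [DecidableEq α] in
/-- There is a set `X ⊆ C` all of whose elements are assigned something that is adjacent only to
elements of `X`, and such that unassigned elements have all their neighbours in `X`. -/
theorem IsAuction.exists_crown {C : Finset (Finset α)} {N : ℕ} {adj : Finset α → α → Prop}
    {cur : Finset α → Option α} {lev : Finset α → ℕ} (h : IsAuction C N adj cur lev) :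
    ∃ X ⊆ C, (∀ Q ∈ X, ∃ o, cur Q = some o ∧ ∀ Q' ∈ C, adj Q' o → Q' ∈ X) ∧
      ∀ o, (∀ Q ∈ C, cur Q ≠ some o) → ∀ Q ∈ C, adj Q o → Q ∈ X := by
  -- Pigeonhole: `N + 1` positive prices and at most `N` sets, so some price `l` is not attained.
  -- The crown consists of the sets above the gap. Prices seen by a holder drop by at most one, so
  -- they cannot jump across it.
  obtain ⟨l, hl, hlC⟩ : ∃ l ∈ Finset.Icc 1 (N + 1), l ∉ C.image lev := by
    refine Finset.exists_mem_notMem_of_card_lt_card (Finset.card_image_le.trans_lt ?_)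
    rw [Nat.card_Icc]
    have := h.card_le
    omega
  rw [Finset.mem_Icc] at hl
  have hne : ∀ Q ∈ C, lev Q ≠ l := fun Q hQ e => hlC (Finset.mem_image.2 ⟨Q, hQ, e⟩)
  refine ⟨C.filter (l < lev ·), Finset.filter_subset _ _, fun Q hQ => ?_, fun o ho Q hQ hQo => ?_⟩
  · rw [Finset.mem_filter] at hQ
    obtain ⟨o, ho⟩ := h.exists_cur Q hQ.1 (by omega)
    refine ⟨o, ho, fun Q' hQ' hadj => Finset.mem_filter.2 ⟨hQ', ?_⟩⟩
    have := h.lev_le_succ Q hQ.1 o ho Q' hQ' hadj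
    have := hne Q' hQ'
    omega
  · have := h.lev_of_free o ho Q hQ hQo
    have := hne Q hQ
    exact Finset.mem_filter.2 ⟨hQ, by omega⟩

/-- In the crown `X`, each packing member `insert o Q` with `Q ∈ X` trades `o` for the element
assigned to `Q`; all other members stay. The map `τ` performs this exchange. -/
theorem IsAuction.setPack {C : Finset (Finset α)} {N : ℕ} {V : Finset α}
    {cur : Finset α → Option α} {lev : Finset α → ℕ}
    (h : IsAuction C N (fun Q o => o ∉ V ∧ insert o Q ∈ S) cur lev)
    (hC : ∀ Q ∈ C, t + 1 ≤ Q.card ∧ Q ⊆ V) {K : Finset (Finset α)} (hKS : ∀ A ∈ K, A ∈ S)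
    (hKt : ∀ A ∈ K, ∀ B ∈ K, A ≠ B → (A ∩ B).card ≤ t)
    (hK : ∀ A ∈ K, A ⊆ V ∨ ∃ Q ∈ C, ∃ o, o ∉ V ∧ A = insert o Q) :
    SetPack t K.card {A | A ∈ S ∧ ∀ a ∈ A, a ∈ V ∨ ∃ Q ∈ C, cur Q = some a} := by
  obtain ⟨X, hXC, hX, hfree⟩ := h.exists_crown
  have key : ∀ A : Finset α, ∃ T : Finset α, A ∈ K →
      (T = A ∧ (∀ Q ∈ X, ∀ o ∉ V, A ≠ insert o Q)) ∨
      ∃ Q ∈ X, ∃ o ∉ V, ∃ o', A = insert o Q ∧ T = insert o' Q ∧ cur Q = some o' := by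
    intro A
    by_cases hA : ∃ Q ∈ X, ∃ o ∉ V, A = insert o Q
    · obtain ⟨Q, hQ, o, ho, hAQ⟩ := hA
      obtain ⟨o', ho', -⟩ := hX Q hQ
      exact ⟨insert o' Q, fun _ => Or.inr ⟨Q, hQ, o, ho, o', hAQ, rfl, ho'⟩⟩
    · push Not at hA
      exact ⟨A, fun _ => Or.inl ⟨rfl, hA⟩⟩
  choose τ hτ using key
  -- An unchanged member cannot contain an element newly handed to `Q ∈ X`: that element is outside
  -- `V` and adjacent only to `X`, so the member would itself be one that is changed.
  have hmix : ∀ A ∈ K, ∀ B ∈ K, (∀ Q ∈ X, ∀ o ∉ V, B ≠ insert o Q) → ∀ Q ∈ X, ∀ o o',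
      A = insert o Q → cur Q = some o' → insert o' Q ∩ B ⊆ A ∩ B := by
    intro A hA B hB hBX Q hQ o o' hAQ ho' a ha
    rw [Finset.mem_inter, Finset.mem_insert] at ha
    obtain ⟨rfl | ha, haB⟩ := ha
    · exfalso
      obtain ⟨haV, -⟩ := h.adj_cur Q (hXC hQ) a ho'
      rcases hK B hB with hBV | ⟨Q', hQ', o', ho', rfl⟩
      · exact haV (hBV haB)
      · have hao : a = o' := by
          rcases Finset.mem_insert.1 haB with h' | h'
          · exact h'
          · exact absurd ((hC Q' hQ').2 h') haV
        subst hao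
        obtain ⟨o, ho, hoX⟩ := hX Q hQ
        obtain rfl : a = o := by simp_all
        exact hBX Q' (hoX Q' hQ' ⟨haV, hKS _ hB⟩) a haV rfl
    · exact Finset.mem_inter.2 ⟨hAQ ▸ Finset.mem_insert_of_mem ha, haB⟩
  have hinter : ∀ A ∈ K, ∀ B ∈ K, A ≠ B → τ A ∩ τ B ⊆ A ∩ B := by
    intro A hA B hB hAB
    rcases hτ A hA with ⟨h1, hA'⟩ | ⟨Q, hQ, o, ho, o', hAQ, hT, hcur⟩ <;>
    rcases hτ B hB with ⟨h2, hB'⟩ | ⟨Q', hQ', p, hp, p', hBQ, hT', hcur'⟩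
    · rw [h1, h2]
    · rw [h1, hT', Finset.inter_comm, Finset.inter_comm A]
      exact hmix B hB A hA hA' Q' hQ' p p' hBQ hcur'
    · rw [h2, hT]
      exact hmix A hA B hB hB' Q hQ o o' hAQ hcur
    -- Two packing members with the same core would share more than `t` elements. Distinct cores
    -- receive distinct elements outside `V`, so only the cores contribute to the new intersection.
    · have hQQ : Q ≠ Q' := by
        rintro rfl
        have h4 := hKt A hA B hB hAB
        have h5 : Q ⊆ A ∩ B := by
          rw [hAQ, hBQ]
          exact Finset.subset_inter (Finset.subset_insert _ _) (Finset.subset_insert _ _)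
        have := Finset.card_le_card h5
        have := (hC Q (hXC hQ)).1
        omega
      rw [hT, hT']
      have ho'V := (h.adj_cur Q (hXC hQ) o' hcur).1
      have hp'V := (h.adj_cur Q' (hXC hQ') p' hcur').1
      have hop : o' ≠ p' := by
        rintro rfl
        exact hQQ (h.inj Q (hXC hQ) Q' (hXC hQ') o' hcur hcur')
      intro a ha
      simp only [Finset.mem_inter, Finset.mem_insert] at ha
      rw [hAQ, hBQ]
      simp only [Finset.mem_inter, Finset.mem_insert]
      have h6 := @(hC Q (hXC hQ)).2
      have h7 := @(hC Q' (hXC hQ')).2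
      grind
  -- If two members had the same image, that image would have at most `t` elements. A changed member
  -- contains a core with more than `t` elements, so neither was changed.
  have hinj : Set.InjOn τ K := by
    intro A hA B hB hAB
    by_contra hne
    have h1 := (Finset.card_le_card (hinter A hA B hB hne)).trans (hKt A hA B hB hne)
    have h3 : ∀ A ∈ K, (τ A).card ≤ t → τ A = A := by
      intro A hA hc
      rcases hτ A hA with ⟨h1, -⟩ | ⟨Q, hQ, o, ho, o', -, hT, -⟩
      · exact h1
      · have := (hC Q (hXC hQ)).1
        have := Finset.card_le_card (Finset.subset_insert o' Q)
        rw [hT] at hc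
        omega
    have h4 : (τ A).card ≤ t := by rw [← hAB, Finset.inter_self] at h1; exact h1
    exact hne (by rw [← h3 A hA h4, ← h3 B hB (hAB ▸ h4), hAB])
  refine ⟨K.image τ, (Finset.card_image_of_injOn hinj).ge, ?_, ?_⟩
  · intro T hT
    obtain ⟨A, hA, rfl⟩ := Finset.mem_image.1 hT
    rcases hτ A hA with ⟨h1, hA'⟩ | ⟨Q, hQ, o, ho, o', hAQ, hT, hcur⟩
    · rw [h1]
      refine ⟨hKS A hA, fun a ha => ?_⟩
      rcases hK A hA with hAV | ⟨Q, hQ, o, ho, rfl⟩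
      · exact Or.inl (hAV ha)
      · rcases Finset.mem_insert.1 ha with rfl | ha
        · right
          by_contra! hno
          -- An outside element in an unchanged member is assigned: if it were free, its core would
          -- lie in `X`.
          exact hA' Q (hfree a hno Q hQ ⟨ho, hKS _ hA⟩) a ho rfl
        · exact Or.inl ((hC Q hQ).2 ha)
    · rw [hT]
      refine ⟨(h.adj_cur Q (hXC hQ) o' hcur).2, fun a ha => ?_⟩
      rcases Finset.mem_insert.1 ha with rfl | ha
      · exact Or.inr ⟨Q, hXC hQ, hcur⟩
      · exact Or.inl ((hC Q (hXC hQ)).2 ha)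
  · intro T hT U hU hTU
    obtain ⟨A, hA, rfl⟩ := Finset.mem_image.1 hT
    obtain ⟨B, hB, rfl⟩ := Finset.mem_image.1 hU
    have hAB : A ≠ B := fun e => hTU (e ▸ rfl)
    exact (Finset.card_le_card (hinter A hA B hB hAB)).trans (hKt A hA B hB hAB)

/-- The size of `M`, given a maximal packing `P`. -/
theorem card_le_of_maximal (hMS : ∀ A ∈ M, A ∈ S)
    (hcap : ∀ Q : Finset α, t + 1 ≤ Q.card → Q.card + 1 ≤ r →
      (M.filter (Q ⊆ ·)).card ≤ (r * k) ^ (r - 1 - Q.card))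
    (htr : t + 2 ≤ r) {P : Finset (Finset α)} (hP : ∀ B ∈ P, B.card ≤ r)
    (hmax : ∀ A ∈ S, ∃ B ∈ P, A = B ∨ t < (A ∩ B).card) :
    M.card ≤ P.card * (1 + r ^ (t + 1) * (r * k) ^ (r - 2 - t)) := by
  -- By maximality of `P`, each member of `M` is in `P` or contains a `(t + 1)`-subset of a member
  -- of `P`. The bound for cores of that size then applies.
  have hsub : M ⊆ P.biUnion fun B => {B} ∪ (B.powersetCard (t + 1)).biUnion fun Q =>
      M.filter (Q ⊆ ·) := by
    intro A hA
    obtain ⟨B, hB, hAB⟩ := hmax A (hMS A hA)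
    refine Finset.mem_biUnion.2 ⟨B, hB, ?_⟩
    rcases hAB with rfl | hAB
    · simp
    · obtain ⟨Q, hQ, hQc⟩ := Finset.exists_subset_card_eq (Nat.succ_le_of_lt hAB)
      refine Finset.mem_union_right _ (Finset.mem_biUnion.2 ⟨Q, ?_, ?_⟩)
      · exact Finset.mem_powersetCard.2 ⟨hQ.trans Finset.inter_subset_right, hQc⟩
      · exact Finset.mem_filter.2 ⟨hA, hQ.trans Finset.inter_subset_left⟩
  refine (Finset.card_le_card hsub).trans (Finset.card_biUnion_le_card_mul _ _ _ fun B hB => ?_)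
  refine (Finset.card_union_le _ _).trans (Nat.add_le_add (by simp) ?_)
  refine (Finset.card_biUnion_le_card_mul _ _ ((r * k) ^ (r - 2 - t)) fun Q hQ => ?_).trans ?_
  · have hc := (Finset.mem_powersetCard.1 hQ).2
    have := hcap Q (by omega) (by omega)
    rwa [hc, show r - 1 - (t + 1) = r - 2 - t by omega] at this
  · rw [Finset.card_powersetCard]
    gcongr
    exact (Nat.choose_le_pow _ _).trans (Nat.pow_le_pow_left (hP B hB) _)

/-- The number of `(r - 1)`-subsets of members of `M`. -/
theorem card_biUnion_powersetCard_le (hMr : ∀ A ∈ M, A.card ≤ r) (hr : 0 < r) :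
    (M.biUnion fun A => A.powersetCard (r - 1)).card ≤ M.card * r := by
  refine Finset.card_biUnion_le_card_mul _ _ _ fun A hA => ?_
  rw [Finset.card_powersetCard]
  refine (Nat.choose_le_choose _ (hMr A hA)).trans (le_of_eq ?_)
  obtain ⟨s, rfl⟩ : ∃ s, r = s + 1 := ⟨r - 1, by omega⟩
  simp

end setPacking

/-! ## The kernelization algorithm -/

section algorithm

variable {Γ α : Type} [DecidableEq α]

/-- The number of common elements of the sets represented by two lists. -/
def interCard (A B : List α) : ℕ := (nub (A.filter fun a => memB a B)).length

/-- A maximal packing, found greedily. -/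
def packing (t : ℕ) (S : List (List α)) : List (List α) :=
  greedy (fun acc A => acc.all fun B => !seteqB A B && leB (interCard A B) t) S

/-- The number of members of `M` that contain `Q`. -/
def supCount (M : List (List α)) (Q : List α) : ℕ := (M.filter fun B => subB Q B).length

/-- The set `A` has a subset of at least `t + 1` and at most `r - 1` elements that is contained
in as many members of `M` as allowed. -/
def hasFullCore (r t k : ℕ) (M : List (List α)) (A : List α) : Bool :=
  (List.range r).any fun i => leB (t + 1) i && (tuples i A).any fun Q =>
    eqB (nub Q).length i && leB ((r * k) ^ (r - 1 - i)) (supCount M Q)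

/-- A maximal subfamily in which no core is contained in too many sets, found greedily. -/
def sparse (r t k : ℕ) (S : List (List α)) : List (List α) :=
  greedy (fun acc A => !(acc.any fun B => seteqB A B) && !hasFullCore r t k acc A) S

/-- The subsets with `r - 1` elements of the members of `M`. -/
def cores (r : ℕ) (M : List (List α)) : List (List α) :=
  M.flatMap fun A => (tuples (r - 1) A).filter fun Q => eqB (nub Q).length (r - 1)

/-- The element `a` is in a member of `M`. -/
def covered (M : List (List α)) (a : α) : Bool := M.any fun B => memB a B

/-- The element `o` is not covered by `M` and completes `Q` to a member of `S`. -/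
def adjB (S M : List (List α)) (Q : List α) (o : α) : Bool :=
  !covered M o && S.any fun A => seteqB (o :: Q) A

/-- The bids for `Q` in the log `L` of an auction, the latest one first. -/
def bids (L : List (List α × α)) (Q : List α) : List (List α × α) :=
  L.filter fun e => seteqB e.1 Q

/-- The latest bid for `Q` is by `o`. -/
def holdsB (L : List (List α × α)) (Q : List α) (o : α) : Bool :=
  !(bids L Q).isEmpty && eqB ((bids L Q).headD (Q, o)).2 o

/-- In the situation described by the log `L`, the element `e.2` may bid for `e.1`: it does not
hold anything, and `e.1` is the cheapest set it is interested in and not too expensive. -/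
def canBid (S M C : List (List α)) (L : List (List α × α)) (e : List α × α) : Bool :=
  adjB S M e.1 e.2 && leB (bids L e.1).length C.length &&
    C.all fun Q => !holdsB L Q e.2 &&
      (!adjB S M Q e.2 || leB (bids L e.1).length (bids L Q).length)

/-- The pairs in the order in which they get an opportunity to bid. -/
def sweeps (E : List α) (C : List (List α)) : List (List α × α) :=
  (List.range (C.length * (C.length + 1) + 1)).flatMap fun _ =>
    C.flatMap fun Q => E.map fun o => (Q, o)

/-- The log of the auction. -/
def auction (E : List α) (S M C : List (List α)) : List (List α × α) :=
  greedy (canBid S M C) (sweeps E C)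

/-- The elements that are covered by `M` or hold something at the end of the auction. -/
def selectElements (E : List α) (M C : List (List α)) (L : List (List α × α)) : List α :=
  E.filter fun a => covered M a || C.any fun Q => holdsB L Q a

/-- The elements that are kept, if `M` has been found. -/
def keptElements (r : ℕ) (E : List α) (S M : List (List α)) : List α :=
  selectElements E M (cores r M) (auction E S M (cores r M))

variable [Enc Γ] [Enc α] [EqPT α]

namespace PT

@[fun_prop]
theorem interCard {f g : Γ → List α} (hf : PT f) (hg : PT g) :
    PT (fun x => interCard (f x) (g x)) := by
  unfold PackingKernel.interCard; fun_prop

@[fun_prop]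
theorem packing (t : ℕ) {S : Γ → List (List α)} (hS : PT S) : PT (fun x => packing t (S x)) := by
  unfold PackingKernel.packing; fun_prop

@[fun_prop]
theorem supCount {M : Γ → List (List α)} {Q : Γ → List α} (hM : PT M) (hQ : PT Q) :
    PT (fun x => supCount (M x) (Q x)) := by
  unfold PackingKernel.supCount; fun_prop

@[fun_prop]
theorem hasFullCore (r t : ℕ) {k : Γ → ℕ} {M : Γ → List (List α)} {A : Γ → List α}
    (hk : PT k) (hM : PT M) (hA : PT A) : PT (fun x => hasFullCore r t (k x) (M x) (A x)) := by
  unfold PackingKernel.hasFullCore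
  refine any_const _ fun i => ?_
  fun_prop

@[fun_prop]
theorem sparse (r t : ℕ) {k : Γ → ℕ} {S : Γ → List (List α)} (hk : PT k) (hS : PT S) :
    PT (fun x => sparse r t (k x) (S x)) := by
  unfold PackingKernel.sparse; fun_prop

@[fun_prop]
theorem cores (r : ℕ) {M : Γ → List (List α)} (hM : PT M) : PT (fun x => cores r (M x)) := by
  unfold PackingKernel.cores; fun_prop

@[fun_prop]
theorem covered {M : Γ → List (List α)} {a : Γ → α} (hM : PT M) (ha : PT a) :
    PT (fun x => covered (M x) (a x)) := by
  unfold PackingKernel.covered; fun_prop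

@[fun_prop]
theorem adjB {S M : Γ → List (List α)} {Q : Γ → List α} {a : Γ → α} (hS : PT S) (hM : PT M)
    (hQ : PT Q) (ha : PT a) : PT (fun x => adjB (S x) (M x) (Q x) (a x)) := by
  unfold PackingKernel.adjB; fun_prop

@[fun_prop]
theorem bids {L : Γ → List (List α × α)} {Q : Γ → List α} (hL : PT L) (hQ : PT Q) :
    PT (fun x => bids (L x) (Q x)) := by
  unfold PackingKernel.bids; fun_prop

@[fun_prop]
theorem holdsB {L : Γ → List (List α × α)} {Q : Γ → List α} {a : Γ → α} (hL : PT L) (hQ : PT Q)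
    (ha : PT a) : PT (fun x => holdsB (L x) (Q x) (a x)) := by
  unfold PackingKernel.holdsB; fun_prop

@[fun_prop]
theorem canBid {S M C : Γ → List (List α)} {L : Γ → List (List α × α)} {e : Γ → List α × α}
    (hS : PT S) (hM : PT M) (hC : PT C) (hL : PT L) (he : PT e) :
    PT (fun x => canBid (S x) (M x) (C x) (L x) (e x)) := by
  unfold PackingKernel.canBid; fun_prop

omit [DecidableEq α] [EqPT α] in
@[fun_prop]
theorem sweeps {E : Γ → List α} {C : Γ → List (List α)} (hE : PT E) (hC : PT C) :
    PT (fun x => sweeps (E x) (C x)) := by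
  unfold PackingKernel.sweeps; fun_prop

@[fun_prop]
theorem auction {E : Γ → List α} {S M C : Γ → List (List α)} (hE : PT E) (hS : PT S) (hM : PT M)
    (hC : PT C) : PT (fun x => auction (E x) (S x) (M x) (C x)) := by
  unfold PackingKernel.auction; fun_prop

@[fun_prop]
theorem selectElements {E : Γ → List α} {M C : Γ → List (List α)} {L : Γ → List (List α × α)}
    (hE : PT E) (hM : PT M) (hC : PT C) (hL : PT L) :
    PT (fun x => selectElements (E x) (M x) (C x) (L x)) := by
  unfold PackingKernel.selectElements; fun_prop

@[fun_prop]
theorem keptElements (r : ℕ) {E : Γ → List α} {S M : Γ → List (List α)} (hE : PT E) (hS : PT S)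
    (hM : PT M) : PT (fun x => keptElements r (E x) (S x) (M x)) := by
  unfold PackingKernel.keptElements; fun_prop

end PT

end algorithm

/-! ### The algorithm on adjacency matrices -/

section graphs

variable {Γ : Type} [Enc Γ]

/-- The entry in row `i` and column `j`. -/
def entry (m : List (List Bool)) (i j : ℕ) : Bool := (m.getD i []).getD j false

/-- The edges of the graph with adjacency matrix `m`. -/
def edges (m : List (List Bool)) : List (Sym2 ℕ) :=
  (List.range m.length).flatMap fun i =>
    ((List.range m.length).filter fun j => entry m i j).map fun j => s(i, j)

/-- The edge sets of the subgraphs isomorphic to the graph with `h` vertices and edge list `D`. -/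
def copiesOf (h : ℕ) (D : List (ℕ × ℕ)) (m : List (List Bool)) : List (List (Sym2 ℕ)) :=
  ((tuples h (List.range m.length)).filter fun v => eqB (nub v).length h &&
      D.all fun e => entry m (v.getD e.1 0) (v.getD e.2 0)).map
    fun v => D.map fun e => s(v.getD e.1 0, v.getD e.2 0)

/-- The edge sets of the subgraphs isomorphic to a graph in the list `F`. -/
def copies (F : List (ℕ × List (ℕ × ℕ))) (m : List (List Bool)) : List (List (Sym2 ℕ)) :=
  F.flatMap fun H => copiesOf H.1 H.2 m

/-- The number with the given binary digits, but at most `c`. -/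
def cappedVal (c : ℕ) (bits : List Bool) : ℕ :=
  bits.foldr (fun b n => min c (2 * n + if b = true then 1 else 0)) 0

/-- The vertices among `0, …, n - 1` that belong to edges in the list `F`. -/
def endpoints (n : ℕ) (F : List (Sym2 ℕ)) : List ℕ :=
  (List.range n).filter fun v => F.any fun e => eqB e.inf v || eqB e.sup v

/-- The adjacency matrix of the graph with edges `F` on the vertices `W`. -/
def matrixOf (W : List ℕ) (F : List (Sym2 ℕ)) : List (List Bool) :=
  W.map fun u => W.map fun v => memB s(u, v) F

/-- The edges of the kernel; here `S` are the copies, and `k` is the parameter, or `|S| + 1` if the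
parameter is larger than that. -/
def kernelEdges (r t k : ℕ) (E : List (Sym2 ℕ)) (S : List (List (Sym2 ℕ))) : List (Sym2 ℕ) :=
  if (eqB (t + 1) r || leB (S.length + 1) k) = true then []
  else keptElements r E S (sparse r t k S)

/-- The kernelization algorithm. -/
def kernelize (F : List (ℕ × List (ℕ × ℕ))) (r t : ℕ) (x : List (List Bool) × List Bool) :
    List (List Bool) × List Bool :=
  if leB (cappedVal ((copies F x.1).length + 1) x.2) (packing t (copies F x.1)).length = true then
    ([], [])
  else
    (matrixOf (endpoints x.1.length (kernelEdges r t (cappedVal ((copies F x.1).length + 1) x.2)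
        (edges x.1) (copies F x.1)))
      (kernelEdges r t (cappedVal ((copies F x.1).length + 1) x.2) (edges x.1) (copies F x.1)), x.2)

namespace PT

@[fun_prop]
theorem entry {m : Γ → List (List Bool)} {i j : Γ → ℕ} (hm : PT m) (hi : PT i) (hj : PT j) :
    PT (fun x => entry (m x) (i x) (j x)) := by
  unfold PackingKernel.entry; fun_prop

@[fun_prop]
theorem edges {m : Γ → List (List Bool)} (hm : PT m) : PT (fun x => edges (m x)) := by
  unfold PackingKernel.edges; fun_prop

@[fun_prop]
theorem copiesOf (h : ℕ) (D : List (ℕ × ℕ)) {m : Γ → List (List Bool)} (hm : PT m) :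
    PT (fun x => copiesOf h D (m x)) := by
  unfold PackingKernel.copiesOf; fun_prop

@[fun_prop]
theorem copies (F : List (ℕ × List (ℕ × ℕ))) {m : Γ → List (List Bool)} (hm : PT m) :
    PT (fun x => copies F (m x)) :=
  flatMap_const F fun _ => by fun_prop

/-- The parameter is given in binary but computed with in unary. The cap, applied after each digit,
keeps the accumulator polynomial. -/
theorem _root_.PackingKernel.cappedVal_le (c : ℕ) (l : List Bool) : cappedVal c l ≤ c := by
  cases l
  · exact Nat.zero_le _
  · exact min_le_left _ _

@[fun_prop]
theorem cappedVal {c : Γ → ℕ} {l : Γ → List Bool} (hc : PT c) (hl : PT l) :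
    PT (fun x => cappedVal (c x) (l x)) := by
  obtain ⟨p, hp⟩ := hc.exists_esize_le
  have : PT (fun x => (l x).reverse.foldl
      (fun n b => Min.min (c x) (2 * n + if b = true then 1 else 0)) 0) := by
    refine foldl (f := fun x n b => Min.min (c x) (2 * n + if b = true then 1 else 0)) hl.reverse
      (const 0) ?_ p fun x l' h => ?_
    · have h1 : PT (fun y : Γ × ℕ × Bool => c y.1) := comp hc (by fun_prop)
      fun_prop
    · refine le_trans ?_ (hp x)
      rw [← List.reverse_reverse l', List.foldl_reverse, esize_nat, esize_nat]
      have := cappedVal_le (c x) l'.reverse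
      unfold PackingKernel.cappedVal at this
      omega
  simp only [List.foldl_reverse] at this
  exact this

@[fun_prop]
theorem endpoints {n : Γ → ℕ} {F : Γ → List (Sym2 ℕ)} (hn : PT n) (hF : PT F) :
    PT (fun x => endpoints (n x) (F x)) := by
  unfold PackingKernel.endpoints; fun_prop

@[fun_prop]
theorem matrixOf {W : Γ → List ℕ} {F : Γ → List (Sym2 ℕ)} (hW : PT W) (hF : PT F) :
    PT (fun x => matrixOf (W x) (F x)) := by
  unfold PackingKernel.matrixOf; fun_prop

@[fun_prop]
theorem kernelEdges (r t : ℕ) {k : Γ → ℕ} {E : Γ → List (Sym2 ℕ)} {S : Γ → List (List (Sym2 ℕ))}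
    (hk : PT k) (hE : PT E) (hS : PT S) : PT (fun x => kernelEdges r t (k x) (E x) (S x)) := by
  unfold PackingKernel.kernelEdges; fun_prop

theorem kernelize (F : List (ℕ × List (ℕ × ℕ))) (r t : ℕ) : PT (kernelize F r t) := by
  unfold PackingKernel.kernelize; fun_prop

end PT

end graphs

/-! ## Correctness of the algorithm -/

/-! ### Greedy selection from a list -/

section greedy

variable {α : Type} {p : List α → α → Bool}

theorem greedy_induction {l : List α} (P : List α → Prop) (h0 : P [])
    (hs : ∀ acc, ∀ a ∈ l, P acc → p acc a = true → P (a :: acc)) : P (greedy p l) := by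
  unfold greedy
  generalize ([] : List α) = acc at h0
  induction l generalizing acc with
  | nil => exact h0
  | cons a l ih =>
    rw [List.foldl_cons]
    refine ih (fun acc b hb => hs acc b (List.mem_cons_of_mem _ hb)) _ ?_
    split
    · exact hs acc a List.mem_cons_self h0 ‹_›
    · exact h0

theorem greedy_concat (l : List α) (a : α) :
    greedy p (l ++ [a]) = if p (greedy p l) a = true then a :: greedy p l else greedy p l := by
  rw [greedy, List.foldl_append]
  rfl

theorem mem_of_mem_greedy {l : List α} {a : α} (h : a ∈ greedy p l) : a ∈ l := by
  refine greedy_induction (p := p) (l := l) (fun acc => ∀ a ∈ acc, a ∈ l) (by simp) ?_ a h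
  intro acc b hb h1 _ c hc
  rcases List.mem_cons.1 hc with rfl | hc
  exacts [hb, h1 c hc]

/-- An element not selected failed the test at some earlier stage. New elements are put in front, so
earlier stages are suffixes of the result. -/
theorem mem_greedy_or {l : List α} {a : α} (h : a ∈ l) :
    a ∈ greedy p l ∨ ∃ acc, acc <:+ greedy p l ∧ p acc a = false := by
  induction l using List.reverseRecOn with
  | nil => simp at h
  | append_singleton l b ih =>
    have hsuf : greedy p l <:+ greedy p (l ++ [b]) := by
      rw [greedy_concat]
      split
      · exact List.suffix_cons _ _
      · exact List.suffix_rfl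
    rcases List.mem_append.1 h with h | h
    · rcases ih h with h | ⟨acc, h1, h2⟩
      · exact Or.inl (hsuf.subset h)
      · exact Or.inr ⟨acc, h1.trans hsuf, h2⟩
    · obtain rfl : a = b := by simpa using h
      cases hp : p (greedy p l) a
      · exact Or.inr ⟨_, hsuf, hp⟩
      · left; rw [greedy_concat, if_pos hp]; exact List.mem_cons_self

theorem le_length_foldl_ite (l acc : List α) : acc.length ≤
    (l.foldl (fun acc a => if p acc a = true then a :: acc else acc) acc).length := by
  induction l generalizing acc with
  | nil => exact le_rfl
  | cons a l ih =>
    refine le_trans ?_ (ih _)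
    dsimp only
    split <;> simp

theorem foldl_ite_of_forall {l acc : List α} (h : ∀ a ∈ l, p acc a = false) :
    l.foldl (fun acc a => if p acc a = true then a :: acc else acc) acc = acc := by
  induction l with
  | nil => rfl
  | cons a l ih =>
    rw [List.foldl_cons, h a List.mem_cons_self]
    exact ih fun b hb => h b (List.mem_cons_of_mem _ hb)

theorem forall_of_length_foldl_ite {l acc : List α}
    (h : (l.foldl (fun acc a => if p acc a = true then a :: acc else acc) acc).length =
      acc.length) : ∀ a ∈ l, p acc a = false := by
  induction l with
  | nil => simp
  | cons a l ih =>
    rw [List.foldl_cons] at h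
    cases hp : p acc a
    · rw [hp] at h
      intro b hb
      rcases List.mem_cons.1 hb with rfl | hb
      exacts [hp, ih h b hb]
    · rw [hp] at h
      have := le_length_foldl_ite (p := p) l (a :: acc)
      simp only [if_true, List.length_cons] at h this
      omega

/-- After sufficiently many passes through the list, no element passes the test any more. -/
theorem greedy_repeat (l : List α) (n : ℕ) :
    n ≤ (greedy p ((List.range n).flatMap fun _ => l)).length ∨
      ∀ a ∈ l, p (greedy p ((List.range n).flatMap fun _ => l)) a = false := by
  induction n with
  | zero => exact Or.inl (Nat.zero_le _)
  | succ n ih =>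
    rw [List.range_succ, List.flatMap_append]
    unfold greedy at *
    rw [List.foldl_append, List.flatMap_singleton]
    generalize List.foldl _ _ ((List.range n).flatMap _) = acc at *
    -- Either the selection is already stable and the next pass changes nothing, or the next pass
    -- selects at least one element.
    by_cases hst : ∀ a ∈ l, p acc a = false
    · rw [foldl_ite_of_forall hst]
      exact Or.inr hst
    · have h1 := le_length_foldl_ite (p := p) l acc
      have h2 := mt (forall_of_length_foldl_ite (p := p)) hst
      have h3 := ih.resolve_right hst
      left
      omega

end greedy

/-! ### Lists of lists as families of finite sets -/

section families

variable {α : Type} [DecidableEq α]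

/-- The family of sets represented by a list of lists. -/
def family (L : List (List α)) : Finset (Finset α) := (L.map List.toFinset).toFinset

theorem mem_family {L : List (List α)} {A : Finset α} :
    A ∈ family L ↔ ∃ B ∈ L, B.toFinset = A := by
  simp [family]

theorem toFinset_mem_family {L : List (List α)} {B : List α} (h : B ∈ L) :
    B.toFinset ∈ family L := mem_family.2 ⟨B, h, rfl⟩

theorem card_family_le (L : List (List α)) : (family L).card ≤ L.length :=
  (List.toFinset_card_le _).trans (by simp)

theorem card_family {L : List (List α)} (h : (L.map List.toFinset).Nodup) :
    (family L).card = L.length := by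
  rw [family, List.toFinset_card_of_nodup h, List.length_map]

theorem interCard_eq (A B : List α) : interCard A B = (A.toFinset ∩ B.toFinset).card := by
  rw [interCard, length_nub]
  congr 1
  ext a
  simp

theorem mem_tuples_toList {A : List α} {Q : Finset α} (h : Q ⊆ A.toFinset) :
    Q.toList ∈ tuples Q.card A :=
  mem_tuples.2 ⟨Q.length_toList, fun a ha => by simpa using h (Finset.mem_toList.1 ha)⟩

theorem packing_pairwise (t : ℕ) (S : List (List α)) : (packing t S).Pairwise fun A B =>
    A.toFinset ≠ B.toFinset ∧ (A.toFinset ∩ B.toFinset).card ≤ t := by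
  refine greedy_induction (fun acc => acc.Pairwise _) List.Pairwise.nil ?_
  intro acc A _ h1 h2
  refine List.pairwise_cons.2 ⟨fun B hB => ?_, h1⟩
  have := List.all_eq_true.1 h2 B hB
  simpa [interCard_eq, ← Bool.not_eq_true] using this

theorem nodup_packing (t : ℕ) (S : List (List α)) :
    ((packing t S).map List.toFinset).Nodup :=
  List.pairwise_map.2 ((packing_pairwise t S).imp fun h => h.1)

theorem family_packing_subset (t : ℕ) (S : List (List α)) :
    family (packing t S) ⊆ family S := by
  intro A hA
  obtain ⟨B, hB, rfl⟩ := mem_family.1 hA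
  exact toFinset_mem_family (mem_of_mem_greedy hB)

theorem setPack_packing (t : ℕ) (S : List (List α)) :
    SetPack t (packing t S).length (family S : Set (Finset α)) := by
  refine ⟨family (packing t S), (card_family (nodup_packing t S)).ge,
    fun A hA => family_packing_subset t S hA, fun A hA B hB hAB => ?_⟩
  obtain ⟨A, hA', rfl⟩ := mem_family.1 hA
  obtain ⟨B, hB', rfl⟩ := mem_family.1 hB
  have : Std.Symm fun A B : List α =>
      A.toFinset ≠ B.toFinset → (A.toFinset ∩ B.toFinset).card ≤ t :=
    ⟨fun A B h h' => by rw [Finset.inter_comm]; exact h h'.symm⟩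
  exact List.Pairwise.forall_of_forall
    (R := fun A B : List α => A.toFinset ≠ B.toFinset → (A.toFinset ∩ B.toFinset).card ≤ t)
    (fun A _ h => absurd rfl h) ((packing_pairwise t S).imp fun h _ => h.2) hA' hB' hAB

theorem packing_maximal (t : ℕ) (S : List (List α)) {A : Finset α} (hA : A ∈ family S) :
    ∃ B ∈ family (packing t S), A = B ∨ t < (A ∩ B).card := by
  obtain ⟨A, hAS, rfl⟩ := mem_family.1 hA
  rcases mem_greedy_or (p := fun acc A => acc.all fun B => !seteqB A B && leB (interCard A B) t) hAS
    with h | ⟨acc, h1, h2⟩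
  · exact ⟨_, toFinset_mem_family h, Or.inl rfl⟩
  · obtain ⟨B, hB, hB'⟩ := List.all_eq_false.1 h2
    refine ⟨_, toFinset_mem_family (h1.subset hB), ?_⟩
    simp only [Bool.and_eq_true, Bool.not_eq_true', leB_iff, interCard_eq, not_and, not_le,
      ← Bool.not_eq_true, seteqB_iff] at hB'
    by_cases h : A.toFinset = B.toFinset
    · exact Or.inl h
    · exact Or.inr (hB' h)

theorem supCount_eq {M : List (List α)} (hM : (M.map List.toFinset).Nodup) (Q : List α) :
    supCount M Q = ((family M).filter (Q.toFinset ⊆ ·)).card := by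
  have h1 : (family M).filter (Q.toFinset ⊆ ·) = family (M.filter fun B => subB Q B) := by
    ext A
    simp only [Finset.mem_filter, mem_family, List.mem_filter, subB_iff]
    constructor
    · rintro ⟨⟨B, hB, rfl⟩, h⟩
      exact ⟨B, ⟨hB, h⟩, rfl⟩
    · rintro ⟨B, ⟨hB, h⟩, rfl⟩
      exact ⟨⟨B, hB, rfl⟩, h⟩
  rw [h1, card_family (hM.sublist (List.filter_sublist.map _))]
  rfl

theorem hasFullCore_iff {r t k : ℕ} {M : List (List α)} (hM : (M.map List.toFinset).Nodup)
    (A : List α) : hasFullCore r t k M A = true ↔ ∃ Q ⊆ A.toFinset, t + 1 ≤ Q.card ∧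
      Q.card + 1 ≤ r ∧ (r * k) ^ (r - 1 - Q.card) ≤ ((family M).filter (Q ⊆ ·)).card := by
  simp only [hasFullCore, List.any_eq_true, List.mem_range, Bool.and_eq_true, leB_iff, eqB_iff,
    length_nub, supCount_eq hM, mem_tuples]
  constructor
  · rintro ⟨i, hi, hti, Q, ⟨-, hQA⟩, rfl, h⟩
    exact ⟨Q.toFinset, fun a ha => by simpa using hQA a (by simpa using ha), hti, hi, h⟩
  · rintro ⟨Q, hQA, hti, hi, h⟩
    refine ⟨Q.card, hi, hti, Q.toList, mem_tuples.1 (mem_tuples_toList hQA), by simp, by simpa⟩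

/-- A list is added only if every relevant core in it is strictly below its bound, and adding it
raises each count by at most one. -/
theorem sparse_induction (r t k : ℕ) (S : List (List α)) :
    ((sparse r t k S).map List.toFinset).Nodup ∧ ∀ Q : Finset α, t + 1 ≤ Q.card → Q.card + 1 ≤ r →
      ((family (sparse r t k S)).filter (Q ⊆ ·)).card ≤ (r * k) ^ (r - 1 - Q.card) := by
  refine greedy_induction (fun acc => (acc.map List.toFinset).Nodup ∧ ∀ Q : Finset α,
    t + 1 ≤ Q.card → Q.card + 1 ≤ r →
      ((family acc).filter (Q ⊆ ·)).card ≤ (r * k) ^ (r - 1 - Q.card)) (by simp [family]) ?_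
  rintro acc A - ⟨h1, h2⟩ h3
  rw [Bool.and_eq_true, Bool.not_eq_true', Bool.not_eq_true', ← Bool.not_eq_true,
    ← Bool.not_eq_true, hasFullCore_iff h1, List.any_eq_true] at h3
  refine ⟨List.nodup_cons.2 ⟨fun h => h3.1 ?_, h1⟩, fun Q hQ hQ' => ?_⟩
  · obtain ⟨B, hB, h⟩ := List.mem_map.1 h
    exact ⟨B, hB, seteqB_iff.2 h.symm⟩
  · have h4 : family (A :: acc) = insert A.toFinset (family acc) := by simp [family]
    rw [h4, Finset.filter_insert]
    split
    · refine (Finset.card_insert_le _ _).trans (Nat.succ_le_of_lt ?_)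
      by_contra! h5
      exact h3.2 ⟨Q, ‹_›, hQ, hQ', h5⟩
    · exact h2 Q hQ hQ'

theorem family_sparse_subset (r t k : ℕ) (S : List (List α)) :
    family (sparse r t k S) ⊆ family S := by
  intro A hA
  obtain ⟨B, hB, rfl⟩ := mem_family.1 hA
  exact toFinset_mem_family (mem_of_mem_greedy hB)

/-- The core that caused the rejection was saturated at that stage and remains so, since the counts
only grow. -/
theorem sparse_maximal (r t k : ℕ) (S : List (List α)) {A : Finset α} (hA : A ∈ family S)
    (hA' : A ∉ family (sparse r t k S)) : ∃ Q ⊆ A, t + 1 ≤ Q.card ∧ Q.card + 1 ≤ r ∧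
      (r * k) ^ (r - 1 - Q.card) ≤ ((family (sparse r t k S)).filter (Q ⊆ ·)).card := by
  obtain ⟨A, hAS, rfl⟩ := mem_family.1 hA
  rcases mem_greedy_or (p := fun acc A => !(acc.any fun B => seteqB A B) &&
    !hasFullCore r t k acc A) hAS with h | ⟨acc, h1, h2⟩
  · exact absurd (toFinset_mem_family h) hA'
  · change acc <:+ sparse r t k S at h1
    rw [Bool.and_eq_false_iff, Bool.not_eq_false', Bool.not_eq_false', List.any_eq_true,
      hasFullCore_iff ((sparse_induction r t k S).1.sublist (h1.sublist.map _))] at h2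
    rcases h2 with ⟨B, hB, h⟩ | ⟨Q, hQ, h3, h4, h5⟩
    · exact absurd (mem_family.2 ⟨B, h1.subset hB, (seteqB_iff.1 h).symm⟩) hA'
    · refine ⟨Q, hQ, h3, h4, h5.trans (Finset.card_le_card (Finset.filter_subset_filter _ ?_))⟩
      intro B hB
      obtain ⟨B, hB', rfl⟩ := mem_family.1 hB
      exact toFinset_mem_family (h1.subset hB')

theorem family_cores (r : ℕ) (M : List (List α)) :
    family (cores r M) = (family M).biUnion fun A => A.powersetCard (r - 1) := by
  ext Q
  simp only [mem_family, cores, List.mem_flatMap, List.mem_filter, eqB_iff, length_nub,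
    Finset.mem_biUnion, Finset.mem_powersetCard]
  constructor
  · rintro ⟨Q, ⟨A, hA, hQ, hc⟩, rfl⟩
    refine ⟨_, ⟨A, hA, rfl⟩, fun a ha => ?_, hc⟩
    simpa using (mem_tuples.1 hQ).2 a (by simpa using ha)
  · rintro ⟨_, ⟨A, hA, rfl⟩, hQ, hc⟩
    exact ⟨Q.toList, ⟨A, hA, hc ▸ mem_tuples_toList hQ, by simpa using hc⟩, by simp⟩

theorem covered_iff {M : List (List α)} {a : α} :
    covered M a = true ↔ a ∈ (family M).biUnion id := by
  simp [covered, mem_family]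

theorem adjB_iff {S M : List (List α)} {Q : List α} {o : α} : adjB S M Q o = true ↔
    o ∉ (family M).biUnion id ∧ insert o Q.toFinset ∈ family S := by
  rw [adjB, Bool.and_eq_true, Bool.not_eq_true', ← Bool.not_eq_true, covered_iff]
  simp only [List.any_eq_true, seteqB_iff, List.toFinset_cons, mem_family]
  simp only [eq_comm]

end families

/-! ### The auction and its invariants -/

section auction

variable {α : Type} [DecidableEq α]

/-- The bids for the set `Q` in the log `L`, the latest one first. -/
def bidsFor (L : List (List α × α)) (Q : Finset α) : List (List α × α) :=
  L.filter fun e => decide (e.1.toFinset = Q)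

theorem bids_eq (L : List (List α × α)) (Q : List α) : bids L Q = bidsFor L Q.toFinset := by
  unfold bids bidsFor
  congr 1
  ext e
  rw [Bool.eq_iff_iff]
  simp

/-- The element that made the latest bid for `Q`. -/
def holder (L : List (List α × α)) (Q : Finset α) : Option α := (bidsFor L Q).head?.map Prod.snd

theorem holdsB_iff {L : List (List α × α)} {Q : List α} {o : α} :
    holdsB L Q o = true ↔ holder L Q.toFinset = some o := by
  rw [holdsB, holder, bids_eq]
  cases bidsFor L Q.toFinset <;> simp

theorem bidsFor_cons (e : List α × α) (L : List (List α × α)) (Q : Finset α) :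
    bidsFor (e :: L) Q = if e.1.toFinset = Q then e :: bidsFor L Q else bidsFor L Q := by
  simp [bidsFor, List.filter_cons]

theorem length_bidsFor_cons (e : List α × α) (L : List (List α × α)) (Q : Finset α) :
    (bidsFor (e :: L) Q).length = (bidsFor L Q).length + if e.1.toFinset = Q then 1 else 0 := by
  rw [bidsFor_cons]; split <;> simp

theorem holder_cons (e : List α × α) (L : List (List α × α)) (Q : Finset α) :
    holder (e :: L) Q = if e.1.toFinset = Q then some e.2 else holder L Q := by
  rw [holder, bidsFor_cons]; split <;> simp [holder]

theorem canBid_iff {S M C : List (List α)} {L : List (List α × α)} {e : List α × α} :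
    canBid S M C L e = true ↔
      (e.2 ∉ (family M).biUnion id ∧ insert e.2 e.1.toFinset ∈ family S) ∧
      (bidsFor L e.1.toFinset).length ≤ C.length ∧
      ∀ Q ∈ family C, holder L Q ≠ some e.2 ∧
        ((e.2 ∉ (family M).biUnion id ∧ insert e.2 Q ∈ family S) →
          (bidsFor L e.1.toFinset).length ≤ (bidsFor L Q).length) := by
  simp only [canBid, Bool.and_eq_true, List.all_eq_true, Bool.or_eq_true, Bool.not_eq_true',
    leB_iff, ← Bool.not_eq_true, holdsB_iff, adjB_iff, bids_eq, and_assoc]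
  refine and_congr_right fun _ => and_congr_right fun _ => and_congr_right fun _ => ?_
  constructor
  · intro h Q hQ
    obtain ⟨B, hB, rfl⟩ := mem_family.1 hQ
    exact ⟨(h B hB).1, fun h' => (h B hB).2.resolve_left (not_not_intro h')⟩
  · intro h B hB
    obtain ⟨h1, h2⟩ := h _ (toFinset_mem_family hB)
    exact ⟨h1, or_iff_not_imp_left.2 fun h' => h2 (not_not.1 h')⟩

omit [DecidableEq α] in
theorem mem_sweeps {E : List α} {C : List (List α)} {e : List α × α} (h : e ∈ sweeps E C) :
    e.1 ∈ C := by
  simp only [sweeps, List.mem_flatMap, List.mem_map] at h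
  obtain ⟨-, -, Q, hQ, o, -, rfl⟩ := h
  exact hQ

theorem isAuction_auction {E : List α} {S M C : List (List α)}
    (hE : ∀ A ∈ family S, A ⊆ E.toFinset) :
    IsAuction (family C) C.length
      (fun Q o => o ∉ (family M).biUnion id ∧ insert o Q ∈ (family S : Set (Finset α)))
      (holder (auction E S M C)) fun Q => (bidsFor (auction E S M C) Q).length := by
  set adj : Finset α → α → Prop := fun Q o =>
    o ∉ (family M).biUnion id ∧ insert o Q ∈ (family S : Set (Finset α)) with hadj
  -- These hold after every bid. The price of a set is its number of bids, and an element bids only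
  -- for a cheapest adjacent set, which costs it one more than the minimum. Later prices only rise,
  -- so the comparison with the neighbours persists. The last clause bounds the number of bids.
  obtain ⟨h1, h2, h3, h4, h5⟩ : let L := auction E S M C
      (∀ Q ∈ family C, ∀ o, holder L Q = some o → adj Q o) ∧
      (∀ Q ∈ family C, (bidsFor L Q).length ≤ C.length + 1) ∧
      (∀ Q ∈ family C, ∀ Q' ∈ family C, ∀ o, holder L Q = some o → holder L Q' = some o → Q = Q') ∧
      (∀ Q ∈ family C, ∀ o, holder L Q = some o → ∀ Q' ∈ family C, adj Q' o →
        (bidsFor L Q).length ≤ (bidsFor L Q').length + 1) ∧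
      L.length = ∑ Q ∈ family C, (bidsFor L Q).length := by
    refine greedy_induction (l := sweeps E C) (fun L =>
      (∀ Q ∈ family C, ∀ o, holder L Q = some o → adj Q o) ∧
      (∀ Q ∈ family C, (bidsFor L Q).length ≤ C.length + 1) ∧
      (∀ Q ∈ family C, ∀ Q' ∈ family C, ∀ o, holder L Q = some o → holder L Q' = some o → Q = Q') ∧
      (∀ Q ∈ family C, ∀ o, holder L Q = some o → ∀ Q' ∈ family C, adj Q' o →
        (bidsFor L Q).length ≤ (bidsFor L Q').length + 1) ∧
      L.length = ∑ Q ∈ family C, (bidsFor L Q).length) (by simp [holder, bidsFor]) ?_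
    rintro L e he ⟨h1, h2, h3, h4, h5⟩ h6
    have heC := toFinset_mem_family (mem_sweeps he)
    obtain ⟨h7, h8, h9⟩ := canBid_iff.1 h6
    simp only [length_bidsFor_cons, holder_cons]
    refine ⟨fun Q hQ o => ?_, fun Q hQ => ?_, fun Q hQ Q' hQ' o => ?_,
      fun Q hQ o ho Q' hQ' ha => ?_, ?_⟩
    · split
      · rintro ⟨⟩
        subst Q
        exact h7
      · exact h1 Q hQ o
    · split
      · subst Q
        omega
      · exact h2 Q hQ
    · intro ho ho'
      split at ho <;> split at ho'
      · subst Q; assumption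
      · cases ho
        exact absurd ho' (h9 Q' hQ').1
      · cases ho'
        exact absurd ho (h9 Q hQ).1
      · exact h3 Q hQ Q' hQ' o ho ho'
    · split at ho
      · cases ho
        subst Q
        have := (h9 Q' hQ').2 ha
        rw [if_pos rfl]
        omega
      · have := h4 Q hQ o ho Q' hQ' ha
        rw [if_neg ‹_›]
        omega
    · rw [Finset.sum_add_distrib, ← h5, Finset.sum_ite_eq, if_pos heC, List.length_cons]
  have hlen : (auction E S M C).length ≤ C.length * (C.length + 1) := by
    rw [h5]
    refine (Finset.sum_le_card_nsmul _ _ _ h2).trans ?_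
    rw [smul_eq_mul]
    exact Nat.mul_le_mul_right _ (card_family_le C)
  -- There is one more sweep than the total number of bids allows, so the auction ends with nobody
  -- able to bid.
  have hstable : ∀ e ∈ C.flatMap fun Q => E.map fun o => (Q, o),
      canBid S M C (auction E S M C) e = false := by
    refine (greedy_repeat (p := canBid S M C) (C.flatMap fun Q => E.map fun o => (Q, o))
      (C.length * (C.length + 1) + 1)).resolve_left ?_
    change ¬ _ ≤ (auction E S M C).length
    omega
  refine ⟨card_family_le C, h1, h2, fun Q hQ hpos => ?_, h3, h4, fun o ho Q hQ hQo => ?_⟩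
  · unfold holder
    cases hb : bidsFor (auction E S M C) Q
    · rw [hb] at hpos; exact absurd hpos (by simp)
    · simp
  -- A free element could still bid for its cheapest neighbour `Q₀` if that price were at most
  -- `C.length`. Stability excludes this.
  · obtain ⟨Q₀, hQ₀, hmin⟩ := Finset.exists_min_image ((family C).filter
      fun Q => o ∉ (family M).biUnion id ∧ insert o Q ∈ family S)
      (fun Q => (bidsFor (auction E S M C) Q).length) ⟨Q, Finset.mem_filter.2 ⟨hQ, hQo⟩⟩
    refine le_trans ?_ (hmin Q (Finset.mem_filter.2 ⟨hQ, hQo⟩))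
    rw [Finset.mem_filter] at hQ₀
    obtain ⟨hQ₀C, hQ₀o⟩ := hQ₀
    obtain ⟨B, hB, rfl⟩ := mem_family.1 hQ₀C
    have hoE : o ∈ E := List.mem_toFinset.1 (hE _ hQ₀o.2 (Finset.mem_insert_self _ _))
    by_contra! hlt
    have := hstable (B, o) (List.mem_flatMap.2 ⟨B, hB, List.mem_map.2 ⟨o, hoE, rfl⟩⟩)
    rw [← Bool.not_eq_true, canBid_iff] at this
    exact this ⟨hQ₀o, by dsimp only; omega, fun Q' hQ' => ⟨ho Q' hQ', fun h =>
      hmin Q' (Finset.mem_filter.2 ⟨hQ', h⟩)⟩⟩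

end auction

/-! ### Correctness and size of the set of kept edges -/

section kernel

variable {r t k : ℕ} {E : List (Sym2 ℕ)} {S : List (List (Sym2 ℕ))}

theorem mem_selectElements {α : Type} [DecidableEq α] {E : List α} {M C : List (List α)}
    {L : List (List α × α)} {a : α} : a ∈ selectElements E M C L ↔
      a ∈ E ∧ (a ∈ (family M).biUnion id ∨ ∃ Q ∈ family C, holder L Q = some a) := by
  simp only [selectElements, List.mem_filter, Bool.or_eq_true, covered_iff, List.any_eq_true,
    holdsB_iff]
  refine and_congr_right fun _ => or_congr_right ⟨?_, ?_⟩
  · rintro ⟨Q, hQ, h⟩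
    exact ⟨_, toFinset_mem_family hQ, h⟩
  · rintro ⟨Q, hQ, h⟩
    obtain ⟨B, hB, rfl⟩ := mem_family.1 hQ
    exact ⟨B, hB, h⟩

theorem kernelEdges_subset {e : Sym2 ℕ} (h : e ∈ kernelEdges r t k E S) : e ∈ E := by
  unfold kernelEdges at h
  split at h
  · simp at h
  · exact (mem_selectElements.1 h).1

theorem setPack_kernelEdges (htr : t + 1 ≤ r) (hE : ∀ A ∈ family S, A ⊆ E.toFinset)
    (hS : ∀ A ∈ family S, A.card ≤ r) (hk : (packing t S).length < min (S.length + 1) k)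
    (h : SetPack t k (family S : Set (Finset (Sym2 ℕ)))) :
    SetPack t k {A | A ∈ (family S : Set (Finset (Sym2 ℕ))) ∧
      A ⊆ (kernelEdges r t (min (S.length + 1) k) E S).toFinset} := by
  -- A packing of size `k` exists, so the cap on the parameter is not active.
  have hkS : k ≤ S.length := (h.le_card le_rfl).trans (card_family_le S)
  rw [min_eq_right (by omega)] at *
  -- If `t + 1 = r`, sets of at most `r` elements sharing more than `t` of them are equal. The
  -- greedy packing is then the whole family and has at least `k` members.
  have htr' : t + 1 ≠ r := by
    rintro rfl
    have : k ≤ (family (packing t S)).card := h.le_card fun A hA => by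
      obtain ⟨B, hB, rfl | hAB⟩ := packing_maximal t S hA
      · exact hB
      · have h1 := hS A hA
        have h2 := hS B (family_packing_subset t S hB)
        have h3 : A ∩ B = A := Finset.eq_of_subset_of_card_le Finset.inter_subset_left (by omega)
        have h4 : A ∩ B = B := Finset.eq_of_subset_of_card_le Finset.inter_subset_right (by omega)
        rwa [← h3, h4]
    have := this.trans (card_family_le _)
    omega
  have hif : ¬ ((eqB (t + 1) r || leB (S.length + 1) k) = true) := by
    simp only [Bool.or_eq_true, eqB_iff, leB_iff]
    omega
  rw [kernelEdges, if_neg hif]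
  obtain ⟨-, hcap⟩ := sparse_induction r t k S
  obtain ⟨K, hc, hKS, hKt, hK⟩ := h.exists_near (fun A hA => hS A hA)
    (fun A hA => family_sparse_subset r t k S hA) hcap
    (fun A hA hA' => sparse_maximal r t k S hA hA') (by omega)
  have hauc := isAuction_auction (M := sparse r t k S) (C := cores r (sparse r t k S)) hE
  have hmem : ∀ Q, Q ∈ family (cores r (sparse r t k S)) ↔
      ∃ A ∈ family (sparse r t k S), Q ⊆ A ∧ Q.card = r - 1 := by
    simp [family_cores, Finset.mem_powersetCard]
  have hfin := hauc.setPack (t := t) (fun Q hQ => ?_) hKS hKt fun A hA => ?_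
  · rw [hc] at hfin
    refine hfin.mono fun A hA => ⟨hA.1, fun a ha => ?_⟩
    rw [List.mem_toFinset]
    exact mem_selectElements.2 ⟨List.mem_toFinset.1 (hE A hA.1 ha), hA.2 a ha⟩
  · obtain ⟨A, hA, hQA, hQ⟩ := (hmem Q).1 hQ
    exact ⟨by omega, hQA.trans (Finset.subset_biUnion_of_mem id hA)⟩
  · rcases hK A hA with h | ⟨Q, o, hQ, ⟨B, hB, hQB⟩, ho, h⟩
    · exact Or.inl h
    · exact Or.inr ⟨Q, (hmem Q).2 ⟨B, hB, hQB, by omega⟩, o, ho, h⟩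

theorem card_kernelEdges_le (htr : t + 1 ≤ r) (hS : ∀ A ∈ family S, A.card ≤ r)
    (hk : (packing t S).length < min (S.length + 1) k) :
    (kernelEdges r t (min (S.length + 1) k) E S).toFinset.card ≤ 4 * r ^ r * k ^ (r - t - 1) := by
  unfold kernelEdges
  split
  · simp
  rename_i hif
  simp only [Bool.or_eq_true, eqB_iff, leB_iff, not_or, not_le] at hif
  rw [min_eq_right (by omega)] at *
  obtain ⟨-, hcap⟩ := sparse_induction r t k S
  set M := sparse r t k S with hM
  have hMS : ∀ A ∈ family M, A ∈ (family S : Set (Finset (Sym2 ℕ))) :=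
    fun A hA => family_sparse_subset r t k S hA
  have hMr : ∀ A ∈ family M, A.card ≤ r := fun A hA => hS A (hMS A hA)
  have h1 := card_le_of_maximal hMS hcap (by omega)
    (fun B hB => hS B (family_packing_subset t S hB)) fun A hA => packing_maximal t S hA
  have h2 := card_biUnion_powersetCard_le hMr (by omega)
  have h3 : ((family M).biUnion id).card ≤ (family M).card * r :=
    Finset.card_biUnion_le_card_mul _ _ _ hMr
  -- At most one element is held per core. The default `s(0, 0)` for cores holding nothing is
  -- harmless, as only an upper bound is needed.
  have h4 : (keptElements r E S M).toFinset ⊆ (family M).biUnion id ∪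
      ((family (cores r M)).image fun Q => (holder (auction E S M (cores r M)) Q).getD s(0, 0)) := by
    intro a ha
    rw [List.mem_toFinset] at ha
    rcases (mem_selectElements.1 ha).2 with h | ⟨Q, hQ, h⟩
    · exact Finset.mem_union_left _ h
    · exact Finset.mem_union_right _ (Finset.mem_image.2 ⟨Q, hQ, by rw [h]; rfl⟩)
  rw [family_cores] at h4
  have h5 := (Finset.card_le_card h4).trans (Finset.card_union_le _ _)
  have h6 := h5.trans (Nat.add_le_add h3 (Finset.card_image_le.trans h2))
  refine h6.trans ?_
  have h7 : (family (packing t S)).card ≤ k := (card_family_le _).trans (by omega)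
  obtain ⟨d, rfl⟩ : ∃ d, r = t + 2 + d := ⟨r - (t + 2), by omega⟩
  have h8 : (family M).card ≤ k * (1 + (t + 2 + d) ^ (t + 1) * ((t + 2 + d) * k) ^ d) := by
    refine h1.trans ?_
    rw [show t + 2 + d - 2 - t = d by omega]
    gcongr
  have hr : 0 < t + 2 + d := by omega
  have hk0 : 0 < k := by omega
  rw [show t + 2 + d - t - 1 = d + 1 by omega]
  -- This absorbs the summand 1 in `h8` at the cost of a factor 2. The other factor 2 in the
  -- constant 4 comes from adding the bounds for covered and held elements.
  have h9 : 1 ≤ (t + 2 + d) ^ (t + 1) * ((t + 2 + d) * k) ^ d :=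
    Nat.mul_pos (Nat.pow_pos hr) (Nat.pow_pos (Nat.mul_pos hr hk0))
  have hring : ∀ s : ℕ, 2 * (k * (s ^ (t + 1) * (s * k) ^ d + s ^ (t + 1) * (s * k) ^ d)) * s =
      4 * s ^ (t + 2 + d) * k ^ (d + 1) := fun s => by ring
  calc (family M).card * (t + 2 + d) + (family M).card * (t + 2 + d)
      = 2 * (family M).card * (t + 2 + d) := by ring
    _ ≤ 2 * (k * ((t + 2 + d) ^ (t + 1) * ((t + 2 + d) * k) ^ d +
        (t + 2 + d) ^ (t + 1) * ((t + 2 + d) * k) ^ d)) * (t + 2 + d) := by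
      gcongr
      exact h8.trans (by gcongr)
    _ = 4 * (t + 2 + d) ^ (t + 2 + d) * k ^ (d + 1) := hring _

end kernel

/-! ## Graphs -/

section graphs

/-- The set `A` consists of the edges of a copy of a member of `𝓗`. -/
def IsCopy (𝓗 : Finset FinGraph) (A : Finset (Sym2 ℕ)) : Prop :=
  ∃ H ∈ 𝓗, ∃ φ : Fin H.order → ℕ, φ.Injective ∧
    (A : Set (Sym2 ℕ)) = Sym2.map φ '' H.graph.edgeSet

theorem IsCopy.card_le {𝓗 : Finset FinGraph} {A : Finset (Sym2 ℕ)} (h : IsCopy 𝓗 A) :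
    A.card ≤ maxEdges 𝓗 := by
  obtain ⟨H, hH, φ, -, hA⟩ := h
  rw [← Set.ncard_coe_finset, hA]
  exact (Set.ncard_image_le (Set.toFinite _)).trans (Finset.le_sup (f := FinGraph.numEdges) hH)

variable {𝓗 : Finset FinGraph} {t k : ℕ} {G : FinGraph}

theorem subgraph_ext_of_edgeSet {A B : G.graph.Subgraph} (hA : ∀ v ∈ A.verts, ∃ u, A.Adj v u)
    (hB : ∀ v ∈ B.verts, ∃ u, B.Adj v u) (h : A.edgeSet = B.edgeSet) : A = B := by
  have hadj : ∀ u v, A.Adj u v ↔ B.Adj u v := fun u v => by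
    rw [← SimpleGraph.Subgraph.mem_edgeSet, h, SimpleGraph.Subgraph.mem_edgeSet]
  refine SimpleGraph.Subgraph.ext (Set.ext fun v => ⟨fun hv => ?_, fun hv => ?_⟩)
    (by ext u v; exact hadj u v)
  · obtain ⟨u, hu⟩ := hA v hv
    exact ((hadj v u).1 hu).fst_mem
  · obtain ⟨u, hu⟩ := hB v hv
    exact ((hadj v u).2 hu).fst_mem

theorem exists_adj_of_iso {H : FinGraph} (hH : ∀ v, ¬ H.graph.IsIsolated v)
    {A : G.graph.Subgraph} (e : A.coe ≃g H.graph) : ∀ v ∈ A.verts, ∃ u, A.Adj v u := by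
  intro v hv
  have := hH (e ⟨v, hv⟩)
  simp only [SimpleGraph.IsIsolated, not_forall, not_not] at this
  obtain ⟨u, hu⟩ := this
  refine ⟨e.symm u, ?_⟩
  have h2 : A.coe.Adj ⟨v, hv⟩ (e.symm u) := by
    rw [← e.map_adj_iff, e.apply_symm_apply]
    exact hu
  exact h2

theorem image_edgeSet_of_iso {H : FinGraph} {A : G.graph.Subgraph} (e : A.coe ≃g H.graph)
    (w : Fin G.order → ℕ) : Sym2.map w '' A.edgeSet =
      Sym2.map (fun a => w (e.symm a : Fin G.order)) '' H.graph.edgeSet := by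
  ext x
  constructor
  · rintro ⟨y, hy, rfl⟩
    induction y using Sym2.ind with
    | _ u v =>
      have huv : A.Adj u v := hy
      refine ⟨s(e ⟨u, huv.fst_mem⟩, e ⟨v, huv.snd_mem⟩), ?_, by simp⟩
      rw [SimpleGraph.mem_edgeSet, e.map_adj_iff]
      exact huv
  · rintro ⟨y, hy, rfl⟩
    induction y using Sym2.ind with
    | _ a b =>
      have hab : A.coe.Adj (e.symm a) (e.symm b) := by
        rw [e.symm.map_adj_iff]
        exact hy
      exact ⟨s((e.symm a : Fin G.order), (e.symm b : Fin G.order)), hab, by simp⟩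

/-- Every vertex of `H` is an end of an edge, so the inclusion of edge sets already forces `φ` to
factor through `w`, and the factor is an injective homomorphism into `G`. -/
theorem exists_subgraph {H : FinGraph} (hH : ∀ v, ¬ H.graph.IsIsolated v) {w : Fin G.order → ℕ}
    (hw : w.Injective) {φ : Fin H.order → ℕ} (hφ : φ.Injective)
    (h : Sym2.map φ '' H.graph.edgeSet ⊆ Sym2.map w '' G.graph.edgeSet) :
    ∃ A : G.graph.Subgraph, Nonempty (A.coe ≃g H.graph) ∧
      Sym2.map w '' A.edgeSet = Sym2.map φ '' H.graph.edgeSet := by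
  have hadj : ∀ a b, H.graph.Adj a b → ∃ u v, G.graph.Adj u v ∧ w u = φ a ∧ w v = φ b := by
    intro a b hab
    obtain ⟨y, hy, hy'⟩ := h ⟨s(a, b), hab, rfl⟩
    induction y using Sym2.ind with
    | _ u v =>
      rw [Sym2.map_mk, Sym2.map_mk, Sym2.eq_iff] at hy'
      rcases hy' with ⟨h1, h2⟩ | ⟨h1, h2⟩
      · exact ⟨u, v, hy, h1, h2⟩
      · exact ⟨v, u, SimpleGraph.Adj.symm hy, h2, h1⟩
  have hψ : ∀ a, ∃ u, w u = φ a := by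
    intro a
    have := hH a
    simp only [SimpleGraph.IsIsolated, not_forall, not_not] at this
    obtain ⟨b, hb⟩ := this
    obtain ⟨u, -, -, hu, -⟩ := hadj a b hb
    exact ⟨u, hu⟩
  choose ψ hψ using hψ
  let f : H.graph →g G.graph := ⟨ψ, fun {a b} hab => by
    obtain ⟨u, v, huv, hu, hv⟩ := hadj a b hab
    rwa [hw ((hψ a).trans hu.symm), hw ((hψ b).trans hv.symm)]⟩
  have hf : Function.Injective f := fun a b hab => hφ (by
    rw [← hψ a, ← hψ b]; exact congrArg w hab)
  let c : SimpleGraph.Copy H.graph G.graph := ⟨f, hf⟩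
  refine ⟨c.toSubgraph, ⟨c.isoToSubgraph.symm⟩, ?_⟩
  rw [image_edgeSet_of_iso c.isoToSubgraph.symm w]
  congr 2
  funext a
  exact hψ a

/-- The naming `w` of the vertices lets the kernel be compared with the original graph: the vertices
of the kernel are renumbered, but under the names they had in `G` its edges are a subset of the old
ones. -/
theorem edgeOverlapPacking_iff (h𝓗 : ∀ H ∈ 𝓗, ∀ v, ¬ H.graph.IsIsolated v)
    {w : Fin G.order → ℕ} (hw : w.Injective) : EdgeOverlapPacking 𝓗 t G k ↔
      SetPack t k {A | IsCopy 𝓗 A ∧ (A : Set (Sym2 ℕ)) ⊆ Sym2.map w '' G.graph.edgeSet} := by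
  classical
  have hinj := Sym2.map.injective hw
  constructor
  · rintro ⟨K, hk, hK, hKt⟩
    let F : G.graph.Subgraph → Finset (Sym2 ℕ) := fun A =>
      (Set.toFinite (Sym2.map w '' A.edgeSet)).toFinset
    have hF : ∀ A, (F A : Set (Sym2 ℕ)) = Sym2.map w '' A.edgeSet := fun A => by simp [F]
    have hFinj : Set.InjOn F K := by
      intro A hA B hB hAB
      obtain ⟨H, hH, ⟨e⟩⟩ := hK A hA
      obtain ⟨H', hH', ⟨e'⟩⟩ := hK B hB
      refine subgraph_ext_of_edgeSet (exists_adj_of_iso (h𝓗 H hH) e)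
        (exists_adj_of_iso (h𝓗 H' hH') e') (hinj.image_injective ?_)
      rw [← hF, ← hF, hAB]
    refine ⟨K.image F, hk.trans (Finset.card_image_of_injOn hFinj).ge, ?_, ?_⟩
    · intro T hT
      obtain ⟨A, hA, rfl⟩ := Finset.mem_image.1 hT
      obtain ⟨H, hH, ⟨e⟩⟩ := hK A hA
      refine ⟨⟨H, hH, _, ?_, (hF A).trans (image_edgeSet_of_iso e w)⟩, ?_⟩
      · exact hw.comp (Subtype.val_injective.comp e.symm.injective)
      · rw [hF]
        exact Set.image_mono A.edgeSet_subset
    · intro T hT U hU hTU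
      obtain ⟨A, hA, rfl⟩ := Finset.mem_image.1 hT
      obtain ⟨B, hB, rfl⟩ := Finset.mem_image.1 hU
      have := hKt A hA B hB fun e => hTU (e ▸ rfl)
      rwa [← Set.ncard_coe_finset, Finset.coe_inter, hF, hF, ← Set.image_inter hinj,
        Set.ncard_image_of_injective _ hinj]
  · rintro ⟨K, hk, hK, hKt⟩
    have hex : ∀ A : Finset (Sym2 ℕ), ∃ B : G.graph.Subgraph, A ∈ K →
        (∃ H ∈ 𝓗, Nonempty (B.coe ≃g H.graph)) ∧ Sym2.map w '' B.edgeSet = A := by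
      intro A
      by_cases hA : A ∈ K
      · obtain ⟨⟨H, hH, φ, hφ, hAφ⟩, hAG⟩ := hK A hA
        rw [hAφ] at hAG
        obtain ⟨B, hB, hB'⟩ := exists_subgraph (h𝓗 H hH) hw hφ hAG
        exact ⟨B, fun _ => ⟨⟨H, hH, hB⟩, hB'.trans hAφ.symm⟩⟩
      · exact ⟨⊥, fun h => absurd h hA⟩
    choose F hF using hex
    have hFinj : Set.InjOn F K := by
      intro A hA B hB hAB
      rw [← Finset.coe_inj, ← (hF A hA).2, ← (hF B hB).2, hAB]
    refine ⟨K.image F, hk.trans (Finset.card_image_of_injOn hFinj).ge, ?_, ?_⟩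
    · intro T hT
      obtain ⟨A, hA, rfl⟩ := Finset.mem_image.1 hT
      exact (hF A hA).1
    · intro T hT U hU hTU
      obtain ⟨A, hA, rfl⟩ := Finset.mem_image.1 hT
      obtain ⟨B, hB, rfl⟩ := Finset.mem_image.1 hU
      have := hKt A hA B hB fun e => hTU (e ▸ rfl)
      rwa [← Set.ncard_coe_finset, Finset.coe_inter, ← (hF A hA).2, ← (hF B hB).2,
        ← Set.image_inter hinj, Set.ncard_image_of_injective _ hinj] at this

end graphs

/-! ### Adjacency matrices, enumeration of copies, and the output graph -/

section encoding

open Classical in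
/-- The adjacency matrix. -/
noncomputable def adjMatrix (G : FinGraph) : List (List Bool) :=
  List.ofFn fun i => List.ofFn fun j => decide (G.graph.Adj i j)

theorem encodeInstance_eq (G : FinGraph) (k : ℕ) :
    encodeInstance G k = enc (adjMatrix G, k.bits) := by
  change Data.cons _ _ = Data.cons _ _
  congr 1
  change encodeList _ = encodeList _
  rw [adjMatrix, List.map_ofFn]
  congr 2
  funext i
  change encodeList _ = encodeList _
  rw [List.map_ofFn]
  rfl

theorem length_adjMatrix (G : FinGraph) : (adjMatrix G).length = G.order := by simp [adjMatrix]

theorem entry_adjMatrix {G : FinGraph} (i j : Fin G.order) :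
    entry (adjMatrix G) i j = true ↔ G.graph.Adj i j := by
  simp [entry, adjMatrix, List.getD_eq_getElem?_getD]

theorem coe_edges_adjMatrix (G : FinGraph) :
    ((edges (adjMatrix G)).toFinset : Set (Sym2 ℕ)) = Sym2.map Fin.val '' G.graph.edgeSet := by
  ext x
  simp only [edges, List.coe_toFinset, Set.mem_ofPred_eq, List.mem_flatMap, List.mem_map,
    List.mem_filter, List.mem_range, length_adjMatrix]
  constructor
  · rintro ⟨i, hi, j, ⟨hj, hij⟩, rfl⟩
    exact ⟨s(⟨i, hi⟩, ⟨j, hj⟩), (entry_adjMatrix ⟨i, hi⟩ ⟨j, hj⟩).1 hij, rfl⟩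
  · rintro ⟨y, hy, rfl⟩
    induction y using Sym2.ind with
    | _ u v => exact ⟨u, u.2, v, ⟨v.2, (entry_adjMatrix u v).2 hy⟩, rfl⟩

open Classical in
/-- A graph as a list of adjacent pairs, together with the number of vertices. -/
noncomputable def pattern (H : FinGraph) : ℕ × List (ℕ × ℕ) :=
  (H.order, ((Finset.univ.filter fun p : Fin H.order × Fin H.order => H.graph.Adj p.1 p.2).toList.map
    fun p => ((p.1 : ℕ), (p.2 : ℕ))))

/-- A tuple of `H.order` vertices with that many distinct entries is an injective map. Conversely,
the map of a copy has its values among the vertices of `G` because no vertex of `H` is isolated. -/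
theorem mem_family_copies {𝓗 : Finset FinGraph} (h𝓗 : ∀ H ∈ 𝓗, ∀ v, ¬ H.graph.IsIsolated v)
    {G : FinGraph} {A : Finset (Sym2 ℕ)} :
    A ∈ family (copies (𝓗.toList.map pattern) (adjMatrix G)) ↔
      IsCopy 𝓗 A ∧ (A : Set (Sym2 ℕ)) ⊆ Sym2.map Fin.val '' G.graph.edgeSet := by
  simp only [mem_family, copies, List.mem_flatMap, List.mem_map, Finset.mem_toList, copiesOf,
    List.mem_filter, mem_tuples, List.mem_range, length_adjMatrix, Bool.and_eq_true, eqB_iff,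
    length_nub, List.all_eq_true]
  constructor
  · rintro ⟨-, ⟨-, ⟨H, hH, rfl⟩, v, ⟨⟨hv, hvG⟩, hvn, hadj⟩, rfl⟩, rfl⟩
    have hvn' : v.Nodup := by
      rw [← hv] at hvn
      exact Multiset.toFinset_card_eq_card_iff_nodup.1 hvn
    change v.length = H.order at hv
    have hget : ∀ a : Fin H.order, v.getD a 0 = v[(a : ℕ)]'(a.2.trans_eq hv.symm) := fun a =>
      List.getD_eq_getElem _ _ _
    have hadj' : ∀ a b : Fin H.order, H.graph.Adj a b →
        entry (adjMatrix G) (v.getD a 0) (v.getD b 0) = true := fun a b hab =>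
      hadj (a, b) (by
        simp only [pattern, List.mem_map, Finset.mem_toList, Finset.mem_filter]
        exact ⟨(a, b), ⟨Finset.mem_univ _, hab⟩, rfl⟩)
    have heq : ((((pattern H).2.map fun e => s(v.getD e.1 0, v.getD e.2 0)).toFinset :
        Finset (Sym2 ℕ)) : Set (Sym2 ℕ)) =
        Sym2.map (fun a : Fin H.order => v.getD a 0) '' H.graph.edgeSet := by
      ext x
      simp only [pattern, List.coe_toFinset, Set.mem_ofPred_eq, List.mem_map, Finset.mem_toList,
        Finset.mem_filter]
      constructor
      · rintro ⟨-, ⟨⟨a, b⟩, ⟨-, hab⟩, rfl⟩, rfl⟩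
        exact ⟨s(a, b), hab, rfl⟩
      · rintro ⟨y, hy, rfl⟩
        induction y using Sym2.ind with
        | _ a b => exact ⟨_, ⟨(a, b), ⟨Finset.mem_univ _, hy⟩, rfl⟩, rfl⟩
    refine ⟨⟨H, hH, _, fun a b hab => ?_, heq⟩, ?_⟩
    · beta_reduce at hab
      rw [hget, hget] at hab
      exact Fin.ext ((hvn'.getElem_inj_iff).1 hab)
    · rw [heq]
      rintro _ ⟨y, hy, rfl⟩
      induction y using Sym2.ind with
      | _ a b =>
        have h := hadj' a b hy
        rw [hget, hget] at h
        have ha := hvG _ (List.getElem_mem (a.2.trans_eq hv.symm))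
        have hb := hvG _ (List.getElem_mem (b.2.trans_eq hv.symm))
        refine ⟨s(⟨_, ha⟩, ⟨_, hb⟩), (entry_adjMatrix ⟨_, ha⟩ ⟨_, hb⟩).1 h, ?_⟩
        rw [Sym2.map_mk, Sym2.map_mk, hget, hget]
  · rintro ⟨⟨H, hH, φ, hφ, hA⟩, hAG⟩
    rw [hA] at hAG
    have hadj : ∀ a b, H.graph.Adj a b → ∃ u v : Fin G.order, G.graph.Adj u v ∧
        (u : ℕ) = φ a ∧ (v : ℕ) = φ b := by
      intro a b hab
      obtain ⟨y, hy, hy'⟩ := hAG ⟨s(a, b), hab, rfl⟩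
      induction y using Sym2.ind with
      | _ u v =>
        rw [Sym2.map_mk, Sym2.map_mk, Sym2.eq_iff] at hy'
        rcases hy' with ⟨h1, h2⟩ | ⟨h1, h2⟩
        · exact ⟨u, v, hy, h1, h2⟩
        · exact ⟨v, u, SimpleGraph.Adj.symm hy, h2, h1⟩
    have hget : ∀ a : Fin H.order, (List.ofFn φ).getD a 0 = φ a := fun a => by
      simp [List.getD_eq_getElem?_getD]
    refine ⟨_, ⟨_, ⟨H, hH, rfl⟩, List.ofFn φ, ⟨⟨by simp [pattern], ?_⟩, ?_, ?_⟩, rfl⟩, ?_⟩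
    · intro x hx
      obtain ⟨a, rfl⟩ := List.mem_ofFn.1 hx
      have := h𝓗 H hH a
      simp only [SimpleGraph.IsIsolated, not_forall, not_not] at this
      obtain ⟨b, hb⟩ := this
      obtain ⟨u, -, -, hu, -⟩ := hadj a b hb
      exact hu ▸ u.2
    · rw [List.toFinset_card_of_nodup (List.nodup_ofFn.2 hφ)]
      simp [pattern]
    · intro e he
      simp only [pattern, List.mem_map, Finset.mem_toList, Finset.mem_filter] at he
      obtain ⟨⟨a, b⟩, ⟨-, hab⟩, rfl⟩ := he
      obtain ⟨u, v, huv, hu, hv⟩ := hadj a b hab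
      dsimp only
      rw [hget, hget, ← hu, ← hv]
      exact (entry_adjMatrix u v).2 huv
    · rw [← Finset.coe_inj, hA]
      ext x
      simp only [pattern, List.coe_toFinset, Set.mem_ofPred_eq, List.mem_map, Finset.mem_toList,
        Finset.mem_filter]
      constructor
      · rintro ⟨-, ⟨⟨a, b⟩, ⟨-, hab⟩, rfl⟩, rfl⟩
        exact ⟨s(a, b), hab, by dsimp only; rw [hget, hget]; rfl⟩
      · rintro ⟨y, hy, rfl⟩
        induction y using Sym2.ind with
        | _ a b =>
          exact ⟨_, ⟨(a, b), ⟨Finset.mem_univ _, hy⟩, rfl⟩, by dsimp only; rw [hget, hget]; rfl⟩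

/-- Capping after each digit loses nothing: once the value reaches `c`, doubling it and adding a
digit keeps it at least `c`. -/
theorem cappedVal_bits (c k : ℕ) : cappedVal c k.bits = min c k := by
  induction k using Nat.binaryRec' with
  | zero => simp [cappedVal]
  | bit b n hn ih =>
    rw [Nat.bits_append_bit n b hn, Nat.bit_val]
    change min c (2 * cappedVal c n.bits + _) = _
    rw [ih]
    cases b <;> simp <;> omega

/-- The graph with the edges in the list `F` on the vertices in the list `W`. -/
def graphOf (W : List ℕ) (F : List (Sym2 ℕ)) (hF : ∀ v, s(v, v) ∉ F) : FinGraph where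
  order := W.length
  graph :=
    { Adj := fun i j => s(W[i], W[j]) ∈ F
      symm := ⟨fun i j h => by rwa [Sym2.eq_swap]⟩
      loopless := ⟨fun i => hF _⟩ }

theorem adjMatrix_graphOf {W : List ℕ} {F : List (Sym2 ℕ)} (hF : ∀ v, s(v, v) ∉ F) :
    adjMatrix (graphOf W F hF) = matrixOf W F := by
  have hmap : ∀ {β : Type} (f : ℕ → β), W.map f = List.ofFn fun i : Fin W.length => f W[i] := by
    intro β f
    refine List.ext_getElem (by simp) fun n h1 h2 => by simp
  rw [matrixOf, hmap]
  refine congrArg List.ofFn (funext fun i => ?_)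
  rw [hmap]
  refine congrArg List.ofFn (funext fun j => ?_)
  rw [Bool.eq_iff_iff, memB_iff]
  exact @decide_eq_true_iff _ (Classical.propDecidable _)

theorem image_edgeSet_graphOf {W : List ℕ} {F : List (Sym2 ℕ)} (hF : ∀ v, s(v, v) ∉ F)
    (hW : ∀ u v, s(u, v) ∈ F → u ∈ W) :
    Sym2.map (fun i : Fin (graphOf W F hF).order => W[(i : ℕ)]'i.2) ''
      (graphOf W F hF).graph.edgeSet = (F.toFinset : Set (Sym2 ℕ)) := by
  ext x
  rw [List.coe_toFinset]
  constructor
  · rintro ⟨y, hy, rfl⟩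
    induction y using Sym2.ind with
    | _ i j => exact hy
  · intro hx
    induction x using Sym2.ind with
    | _ u v =>
      obtain ⟨i, hi, rfl⟩ := List.getElem_of_mem (hW u v hx)
      obtain ⟨j, hj, rfl⟩ := List.getElem_of_mem (hW v _ (by rwa [Sym2.eq_swap]))
      exact ⟨s(⟨i, hi⟩, ⟨j, hj⟩), hx, rfl⟩

theorem mem_endpoints {n : ℕ} {F : List (Sym2 ℕ)} {v : ℕ} :
    v ∈ endpoints n F ↔ v < n ∧ ∃ e ∈ F, e.inf = v ∨ e.sup = v := by
  simp [endpoints]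

theorem nodup_endpoints (n : ℕ) (F : List (Sym2 ℕ)) : (endpoints n F).Nodup :=
  List.nodup_range.filter _

theorem length_endpoints_le (n : ℕ) (F : List (Sym2 ℕ)) :
    (endpoints n F).length ≤ 2 * F.toFinset.card := by
  rw [← List.toFinset_card_of_nodup (nodup_endpoints n F), mul_comm]
  have : (endpoints n F).toFinset ⊆ F.toFinset.biUnion fun e => {e.inf, e.sup} := by
    intro v hv
    rw [List.mem_toFinset, mem_endpoints] at hv
    obtain ⟨-, e, he, h⟩ := hv
    simp only [Finset.mem_biUnion, List.mem_toFinset, Finset.mem_insert, Finset.mem_singleton]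
    exact ⟨e, he, by tauto⟩
  exact (Finset.card_le_card this).trans (Finset.card_biUnion_le_card_mul _ _ _
    fun _ _ => Finset.card_le_two)

end encoding

/-! ### Assembling the kernel -/

theorem PT.hasVertexKernel {Q : FinGraph → ℕ → Prop} {s : ℕ → ℕ}
    {f : List (List Bool) × List Bool → List (List Bool) × List Bool} (hf : PT f)
    (h : ∀ G k, ∃ (G' : FinGraph) (k' : ℕ), f (adjMatrix G, k.bits) = (adjMatrix G', k'.bits) ∧
      (Q G k ↔ Q G' k') ∧ k' ≤ k ∧ G'.order ≤ s k) : HasVertexKernel Q s := by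
  obtain ⟨c, p, hc⟩ := hf
  refine ⟨c, p, fun G k => ?_⟩
  obtain ⟨G', k', h1, h2⟩ := h G k
  obtain ⟨n, h3, h4⟩ := hc (adjMatrix G, k.bits)
  rw [h1, ← encodeInstance_eq, ← encodeInstance_eq] at h3
  rw [← encodeInstance_eq] at h4
  exact ⟨G', k', n, h3, h4, h2⟩

theorem hasVertexKernel_edgeOverlapPacking {𝓗 : Finset FinGraph} {t : ℕ}
    (h𝓗 : ∀ H ∈ 𝓗, ∀ v : Fin H.order, ¬ H.graph.IsIsolated v) (htr : t + 1 ≤ maxEdges 𝓗) :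
    HasVertexKernel (EdgeOverlapPacking 𝓗 t)
      (fun k => 8 * maxEdges 𝓗 ^ maxEdges 𝓗 * k ^ (maxEdges 𝓗 - t - 1)) := by
  refine PT.hasVertexKernel (PT.kernelize (𝓗.toList.map pattern) (maxEdges 𝓗) t) fun G k => ?_
  set S := copies (𝓗.toList.map pattern) (adjMatrix G) with hS
  have hQ : EdgeOverlapPacking 𝓗 t G k ↔ SetPack t k (family S : Set (Finset (Sym2 ℕ))) := by
    rw [edgeOverlapPacking_iff h𝓗 Fin.val_injective]
    refine iff_of_eq (congrArg _ (Set.ext fun A => ?_))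
    exact (mem_family_copies h𝓗).symm
  rw [hQ, kernelize, ← hS, cappedVal_bits]
  split
  · rename_i hle
    rw [leB_iff] at hle
    -- The test used the capped parameter, but a packing has at most `S.length` members, so the cap
    -- `S.length + 1` was not the minimum.
    have hkP : k ≤ (packing t S).length := by
      have : (packing t S).length ≤ S.length := by
        rw [← card_family (nodup_packing t S)]
        exact (Finset.card_le_card (family_packing_subset t S)).trans (card_family_le S)
      omega
    refine ⟨⟨0, ⊥⟩, 0, rfl, iff_of_true ?_ ⟨∅, by simp⟩, Nat.zero_le _, Nat.zero_le _⟩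
    obtain ⟨K, h1, h2, h3⟩ := setPack_packing t S
    exact ⟨K, hkP.trans h1, h2, h3⟩
  · rename_i hlt
    rw [leB_iff, not_le] at hlt
    have hE : ∀ A ∈ family S, A ⊆ (edges (adjMatrix G)).toFinset := fun A hA => by
      rw [← Finset.coe_subset, coe_edges_adjMatrix]
      exact ((mem_family_copies h𝓗).1 hA).2
    have hr : ∀ A ∈ family S, A.card ≤ maxEdges 𝓗 :=
      fun A hA => ((mem_family_copies h𝓗).1 hA).1.card_le
    have hcard := card_kernelEdges_le (E := edges (adjMatrix G)) htr hr hlt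
    have hpack := setPack_kernelEdges (E := edges (adjMatrix G)) htr hE hr hlt
    have hsub : ∀ e ∈ kernelEdges (maxEdges 𝓗) t (min (S.length + 1) k) (edges (adjMatrix G)) S,
        e ∈ Sym2.map Fin.val '' G.graph.edgeSet := fun e he => by
      rw [← coe_edges_adjMatrix, List.coe_toFinset]
      exact kernelEdges_subset he
    rw [length_adjMatrix]
    generalize kernelEdges (maxEdges 𝓗) t (min (S.length + 1) k) (edges (adjMatrix G)) S = F at *
    have hF : ∀ v, s(v, v) ∉ F := by
      intro v hv
      obtain ⟨y, hy, hy'⟩ := hsub _ hv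
      induction y using Sym2.ind with
      | _ a b =>
        rw [Sym2.map_mk, Sym2.eq_iff] at hy'
        have hab : a = b := Fin.ext (by omega)
        exact G.graph.loopless.irrefl b (hab ▸ hy)
    have hW : ∀ u v, s(u, v) ∈ F → u ∈ endpoints G.order F := by
      intro u v huv
      refine mem_endpoints.2 ⟨?_, s(u, v), huv, ?_⟩
      · obtain ⟨y, hy, hy'⟩ := hsub _ huv
        induction y using Sym2.ind with
        | _ a b =>
          rw [Sym2.map_mk, Sym2.eq_iff] at hy'
          have := a.2
          have := b.2
          omega
      · rw [Sym2.inf_mk, Sym2.sup_mk]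
        rcases le_total u v with h | h
        · exact Or.inl (min_eq_left h)
        · exact Or.inr (max_eq_left h)
    refine ⟨graphOf (endpoints G.order F) F hF, k, by rw [adjMatrix_graphOf], ?_, le_rfl, ?_⟩
    · rw [edgeOverlapPacking_iff h𝓗 (w := fun i => (endpoints G.order F)[(i : ℕ)]'i.2)
        fun i j hij => Fin.ext ((nodup_endpoints G.order F).getElem_inj_iff.1 hij),
        image_edgeSet_graphOf hF hW]
      -- The crown argument gives one direction. The other holds because the kernel is a subgraph of
      -- `G` up to the names of its vertices and `k` is unchanged.
      refine ⟨fun h => (hpack h).mono fun A hA => ?_, fun h => h.mono fun A hA => ?_⟩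
      · exact ⟨((mem_family_copies h𝓗).1 hA.1).1, Finset.coe_subset.2 hA.2⟩
      · exact (mem_family_copies h𝓗).2 ⟨hA.1, fun e he => hsub e (by simpa using hA.2 he)⟩
    · refine (length_endpoints_le G.order F).trans ((Nat.mul_le_mul_left 2 hcard).trans
        (le_of_eq ?_))
      ring

end PackingKernel

theorem mainTheorem8 :
    ∃ C : ℕ, ∀ (𝓗 : Finset PackingKernel.FinGraph) (t : ℕ),
      (∀ H ∈ 𝓗, ∀ v : Fin H.order, ¬ H.graph.IsIsolated v) →
      t + 1 ≤ PackingKernel.maxEdges 𝓗 →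
      PackingKernel.HasVertexKernel (PackingKernel.EdgeOverlapPacking 𝓗 t)
        (fun k => C * PackingKernel.maxEdges 𝓗 ^ PackingKernel.maxEdges 𝓗 *
          k ^ (PackingKernel.maxEdges 𝓗 - t - 1)) :=
  ⟨8, fun _ _ => PackingKernel.hasVertexKernel_edgeOverlapPacking⟩
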